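/- Let $L>0$, $S=\mathbb R\times(0,L)$, and let $\varepsilon_{\mathrm p}\in L^\infty(S)$ be real-valued, essentially bounded below by a positive constant, and $1$-periodic in $x_1$. Let $\gamma$ denote one of the lateral boundary conditions on $(0,L)$: Dirichlet ($v(0)=v(L)=0$), Neumann ($v'(0)=v'(L)=0$), mixed ($v(0)=v'(L)=0$), or $\beta$-quasi-periodic ($v(L)=e^{i\beta}v(0)$, $v'(L)=e^{i\beta}v'(0)$, $\beta\in\mathbb R$). Let $\Omega=\mathbb R/\mathbb Z\times(0,L)$, let $H^2_\gamma(\Omega)$ be the space of $H^2$ functions on $\Omega$ that satisfy the boundary condition $\gamma$ in $x_2$, and put $\Delta_\xi=\Delta+2i\xi\partial_{x_1}-\xi^2$ for $\xi\in\mathbb C$. An analytic band consists of an open set $\mathcal U_m\subset\mathbb C$ and holomorphic maps $\lambda_m:\mathcal U_m\to\mathbb C$ and $\mathcal U_m\to L^2(\Omega)$, $\xi\mapsto w_{m,\xi}$, with $0\ne w_{m,\xi}\in H^2_\gamma(\Omega)$ and $$\Delta_\xi w_{m,\xi}+\lambda_m(\xi)\,\varepsilon_{\mathrm p}\,w_{m,\xi}=0\qquad\text{for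 all }\xi\in\mathcal U_m .$$ On $\mathcal U_m\cap\mathbb R$ the function $\lambda_m$ is real-valued, and $\lambda_m'$ denotes its derivative. For functions $v,w$ on $S$ whose cross-sectional traces $x_1\mapsto v(x_1,\cdot)$, $x_1\mapsto w(x_1,\cdot)$ are $C^1$ with values in $L^2((0,L))$ let $$q_{x_1}(v,w)=\int_0^L\Big(\frac{\partial v}{\partial x_1}(x)\overline{w(x)}-v(x)\overline{\frac{\partial w}{\partial x_1}(x)}\Big)\,dx_2 .$$ Let $(\mathcal U_m,\lambda_m,w_m)_{m\in\mathbb N}$ be any family of analytic bands, let $\omega>0$, and let $\xi^*\in\mathbb R\cap\mathcal U_m$ with $\lambda_m(\xi^*)=\omega^2$ and $\lambda_m'(\xi^*)\neq0$. Then the Floquet mode $v(x)=w_{m,\xi^*}(x)e^{i\xi^*x_1}$ has $C^1$ cross-sectional traces in $L^2((0,L))$, and the following are equivalent: 1. $v$ has positive energy flux, i.e. $\operatorname{Im}q(v,v)>0$ (that is, for each $x_1\in\mathbb R$, $\operatorname{Im}q_{x_1}(v,v)>0$ is equivalent to statement 2); 2. $v$ has positive group velocity $\frac{d\sqrt{\lambda_m(\xi)}}{d\xi}\big|_{\xi=\xi^*}>0$,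 i.e. $\lambda_m'(\xi^*)>0$. Moreover, if $\xi^*\in\mathcal U_n$, $\lambda_n(\xi^*)=\omega^2$ and $\lambda_n'(\xi^*)\neq\lambda_m'(\xi^*)$, then $\tilde v(x)=w_{n,\xi^*}(x)e^{i\xi^*x_1}$ also has $C^1$ cross-sectional traces in $L^2((0,L))$, and $q(v,\tilde v)=0$, i.e. $q_{x_1}(v,\tilde v)=0$ for all $x_1\in\mathbb R$. -/

import Mathlib

noncomputable section

namespace PeriodicWaveguide

open MeasureTheory Set
open scoped ContDiff ComplexConjugate

/-- The lateral boundary conditions on the cross section `(0, L)`: Dirichlet `v(0) = v(L) = 0`,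
Neumann `v'(0) = v'(L) = 0`, mixed `v(0) = v'(L) = 0`, and `β`-quasi-periodic
`v(L) = e^{iβ} v(0)`, `v'(L) = e^{iβ} v'(0)`. -/
inductive LateralBC : Type
  | dirichlet : LateralBC
  | neumann : LateralBC
  | mixed : LateralBC
  | quasiPeriodic (β : ℝ) : LateralBC

namespace LateralBC

/-- Index set of the eigenfunctions of `-d²/dt²` on `(0, L)` with the given boundary condition. -/
def index : LateralBC → Set ℤ
  | dirichlet => {k | 1 ≤ k}
  | neumann => {k | 0 ≤ k}
  | mixed => {k | 1 ≤ k}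
  | quasiPeriodic _ => univ

/-- Square root `κ_k` (up to sign) of the eigenvalue with index `k`. -/
def freq (L : ℝ) : LateralBC → ℤ → ℝ
  | dirichlet, k => Real.pi * k / L
  | neumann, k => Real.pi * k / L
  | mixed, k => Real.pi * (2 * k - 1) / (2 * L)
  | quasiPeriodic β, k => (β + 2 * Real.pi * k) / L

/-- The eigenfunctions `ψ_k` of `-d²/dt²` on `(0, L)`, with eigenvalue `κ_k²`. For `k` in
`index` they form a complete orthonormal system of `L²((0, L))`. -/
def eigenfun (L : ℝ) : LateralBC → ℤ → ℝ → ℂ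
  | dirichlet, k, t => ((√(2 / L) * Real.sin (freq L dirichlet k * t) : ℝ) : ℂ)
  | neumann, k, t =>
      (((if k = 0 then √(1 / L) else √(2 / L)) * Real.cos (freq L neumann k * t) : ℝ) : ℂ)
  | mixed, k, t => ((√(2 / L) * Real.sin (freq L mixed k * t) : ℝ) : ℂ)
  | quasiPeriodic β, k, t =>
      (√(1 / L) : ℂ) * Complex.exp (Complex.I * (freq L (quasiPeriodic β) k : ℂ) * (t : ℂ))

end LateralBC

/-- The infinite strip `S = ℝ × (0, L)`. -/
def strip (L : ℝ) : Set (ℝ × ℝ) := univ ×ˢ Ioo 0 L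

/-- Lebesgue measure on the cross section `(0, L)`. -/
def crossMeasure (L : ℝ) : Measure ℝ := volume.restrict (Ioo 0 L)

/-- `L²((0, L))`. -/
abbrev CrossL2 (L : ℝ) : Type := Lp ℂ 2 (crossMeasure L)

/-- Lebesgue measure on the period cell `Ω = ℝ/ℤ × (0, L)`. -/
def cellMeasure (L : ℝ) : Measure (UnitAddCircle × ℝ) :=
  (volume : Measure UnitAddCircle).prod (crossMeasure L)

/-- `L²(Ω)`. -/
abbrev CellL2 (L : ℝ) : Type := Lp ℂ 2 (cellMeasure L)

/-- The coefficient `û(l) = ⟨u, φ_l⟩_{L²(Ω)}` with respect to the orthonormal system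
`φ_l(x) = e^{2πi l₁ x₁} ψ_{l₂}(x₂)`. -/
def cellCoeff (L : ℝ) (γ : LateralBC) (u : CellL2 L) (l : ℤ × ℤ) : ℂ :=
  ∫ x : UnitAddCircle × ℝ, u x * conj (fourier l.1 x.1 * γ.eigenfun L l.2 x.2) ∂(cellMeasure L)

/-- The Sobolev space `H²_γ(Ω)` of `H²` functions on the period cell that satisfy the lateral
boundary condition, defined by the decay of the coefficients with respect to the `φ_l`. -/
def H2 (L : ℝ) (γ : LateralBC) : Set (CellL2 L) :=
  {u | Summable fun l : ℤ × γ.index =>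
    (1 + (2 * Real.pi * l.1) ^ 2 + γ.freq L l.2 ^ 2) ^ 2 * ‖cellCoeff L γ u (l.1, l.2)‖ ^ 2}

/-- A function on `Ω`, read as a function of `(x₁, x₂)` that has period `1` in `x₁`. -/
def periodicLift {L : ℝ} (u : CellL2 L) (x : ℝ × ℝ) : ℂ := u ((x.1 : UnitAddCircle), x.2)

/-- The partial derivative `∂/∂x₁` of a smooth function. -/
def partial₁ (φ : ℝ × ℝ → ℂ) (x : ℝ × ℝ) : ℂ := fderiv ℝ φ x (1, 0)

/-- The partial derivative `∂/∂x₂` of a smooth function. -/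
def partial₂ (φ : ℝ × ℝ → ℂ) (x : ℝ × ℝ) : ℂ := fderiv ℝ φ x (0, 1)

/-- `Δ_ξ φ = Δφ + 2iξ ∂₁φ - ξ² φ`, i.e. `e^{-iξx₁} Δ (e^{iξx₁} φ)`, for smooth `φ`. -/
def twistedLaplacian (ξ : ℂ) (φ : ℝ × ℝ → ℂ) (x : ℝ × ℝ) : ℂ :=
  partial₁ (partial₁ φ) x + partial₂ (partial₂ φ) x
    + 2 * Complex.I * ξ * partial₁ φ x - ξ ^ 2 * φ x

/-- `Δ_ξ u + μ ε u = 0` in the strip in the sense of distributions; the transpose of `Δ_ξ` with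
respect to the bilinear pairing `∫ u φ` is `Δ_{-ξ}`. -/
def SolvesCellEquation {L : ℝ} (ε : ℝ × ℝ → ℝ) (ξ μ : ℂ) (u : CellL2 L) : Prop :=
  ∀ φ : ℝ × ℝ → ℂ, ContDiff ℝ ∞ φ → HasCompactSupport φ → tsupport φ ⊆ strip L →
    ∫ x in strip L, (periodicLift u x * twistedLaplacian (-ξ) φ x
      + μ * (ε x : ℂ) * periodicLift u x * φ x) = 0

/-- The permittivity: `ε ∈ L^∞(S)`, of period `1` in `x₁`, essentially bounded away from `0`. -/
structure IsPermittivity (L : ℝ) (ε : ℝ × ℝ → ℝ) : Prop where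
  aemeasurable : AEMeasurable ε (volume.restrict (strip L))
  periodic : ∀ x ∈ strip L, ε (x.1 + 1, x.2) = ε x
  lower : ∃ c : ℝ, 0 < c ∧ ∀ᵐ x ∂(volume.restrict (strip L)), c ≤ ε x
  upper : ∃ C : ℝ, ∀ᵐ x ∂(volume.restrict (strip L)), ε x ≤ C

/-- `u` is an eigenfunction of `-ε⁻¹ Δ_ξ : H²_γ(Ω) → L²(Ω)` for the eigenvalue `μ`. -/
structure IsCellEigenfunction (L : ℝ) (γ : LateralBC) (ε : ℝ × ℝ → ℝ) (ξ μ : ℂ) (u : CellL2 L) :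
    Prop where
  ne_zero : u ≠ 0
  mem_H2 : u ∈ H2 L γ
  equation : SolvesCellEquation ε ξ μ u

/-- An analytic band on an open set `U` of complex quasi momenta: a holomorphic `lam : U → ℂ`
and a holomorphic `w : U → L²(Ω)` such that `w ξ` is an eigenfunction of `-ε⁻¹ Δ_ξ` for the
eigenvalue `lam ξ`, for every `ξ ∈ U`. -/
structure IsBand (L : ℝ) (γ : LateralBC) (ε : ℝ × ℝ → ℝ) (U : Set ℂ) (lam : ℂ → ℂ)
    (w : ℂ → CellL2 L) : Prop where
  isOpen : IsOpen U
  lam_holomorphic : DifferentiableOn ℂ lam U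
  w_holomorphic : DifferentiableOn ℂ w U
  eigen : ∀ ξ ∈ U, IsCellEigenfunction L γ ε ξ (lam ξ) (w ξ)

/-- `λ'(ξ)`: the derivative of the band function along the real axis (where it is real). -/
def bandSlope (lam : ℂ → ℂ) (ξ : ℝ) : ℝ := deriv (fun α : ℝ => (lam α).re) ξ

/-- The group velocity `dω/dξ = d√λ/dξ`. -/
def groupVelocity (lam : ℂ → ℂ) (ξ : ℝ) : ℝ := deriv (fun α : ℝ => √(lam α).re) ξ

/-- The function `v(x) = u(x) e^{iξx₁}` on the strip. -/
def floquetMode {L : ℝ} (ξ : ℝ) (u : CellL2 L) (x : ℝ × ℝ) : ℂ :=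
  periodicLift u x * Complex.exp (Complex.I * (ξ : ℂ) * (x.1 : ℂ))

/-- `g` is the `C¹` curve `x₁ ↦ v(x₁, ·)` of cross-sectional traces of `v` in `L²((0, L))`. Then
`g x₁` and `deriv g x₁` are the traces of `v` and `∂v/∂x₁` on `{x₁} × (0, L)`. -/
def IsTraceCurve (L : ℝ) (v : ℝ × ℝ → ℂ) (g : ℝ → CrossL2 L) : Prop :=
  ContDiff ℝ 1 g ∧ ∀ᵐ x₁ : ℝ, (g x₁ : ℝ → ℂ) =ᵐ[crossMeasure L] fun x₂ => v (x₁, x₂)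

/-- The curve of traces is unique. -/
theorem IsTraceCurve.unique {L : ℝ} {v : ℝ × ℝ → ℂ} {g h : ℝ → CrossL2 L}
    (hg : IsTraceCurve L v g) (hh : IsTraceCurve L v h) : g = h := by
  refine (Continuous.ae_eq_iff_eq (volume : Measure ℝ) hg.1.continuous hh.1.continuous).1 ?_
  filter_upwards [hg.2, hh.2] with x hx hx'
  exact Lp.ext (hx.trans hx'.symm)

/-- `v` has `L²((0, L))`-traces on all cross sections, with a `C¹` dependence on `x₁`. -/
def HasTraces (L : ℝ) (v : ℝ × ℝ → ℂ) : Prop := ∃ g, IsTraceCurve L v g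

open Classical in
/-- The curve `x₁ ↦ v(x₁, ·)` of traces (with the value `0` if there is none). -/
def traceCurve (L : ℝ) (v : ℝ × ℝ → ℂ) : ℝ → CrossL2 L :=
  if h : HasTraces L v then h.choose else 0

theorem IsTraceCurve.traceCurve_eq {L : ℝ} {v : ℝ × ℝ → ℂ} {g : ℝ → CrossL2 L}
    (hg : IsTraceCurve L v g) : traceCurve L v = g := by
  have h : HasTraces L v := ⟨g, hg⟩
  rw [traceCurve, dif_pos h]
  exact h.choose_spec.unique hg

/-- The sesquilinear form
`q_{x₁}(v, w) = ∫_0^L (∂₁v(x) conj(w(x)) - v(x) conj(∂₁w(x))) dx₂`, `x = (x₁, x₂)`. -/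
def fluxForm (L : ℝ) (x₁ : ℝ) (v w : ℝ × ℝ → ℂ) : ℂ :=
  ∫ x₂, ((deriv (traceCurve L v) x₁ : CrossL2 L) x₂ * conj ((traceCurve L w x₁ : CrossL2 L) x₂)
    - (traceCurve L v x₁ : CrossL2 L) x₂ * conj ((deriv (traceCurve L w) x₁ : CrossL2 L) x₂))
      ∂(crossMeasure L)

end PeriodicWaveguide

end

noncomputable section

namespace PeriodicWaveguide

open MeasureTheory Set Filter Topology
open scoped ContDiff ComplexConjugate InnerProductSpace ENNReal

/-! ### Completeness of the trigonometric systems on an interval -/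

/-! Everything is computed in the modes `e^{2πinx₁} ψ_j(x₂)`, a Hilbert basis of `L²((0,1) ×
(0,L))`. On them `-Δ_ξ` acts as multiplication by the symbol `(2πn+ξ)² + κ_j²`. For a function in
`H2` the distributional equation is therefore the algebraic identity "symbol times coefficient of
`v` equals `μ` times coefficient of `εv`" (`symbol_mul_cellCoeff`).

Let `V` be the band function and `u` any eigenfunction for the same real `ξ` and `μ`. The flux of
their Floquet modes at `x₁` is a double series over wave numbers `2πn+ξ` and `2πm+ξ`. Grouped by `p
= n - m`, it is `i ∑_p e^{2πipx₁} S_p`, where `S_p` sums the coefficient products weighted by the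
sum of the two wave numbers (`inner_waveCurve_sub`).

For `p ≠ 0` the weight is the difference of two symbols divided by `2πp`. The two equations turn
`S_p` into a difference of two inner products, which agree because multiplication by the real
function `ε` is self-adjoint and commutes with `e^{2πipx₁}`. Hence `S_p = 0` (`hasSum_shifted`).

For `p = 0` the weight is the `ξ`-derivative of the symbol. Differentiating the coefficient equation
along the band and pairing with `u` gives `S_0 = λ' ⟨u, εV⟩`, a Hellmann–Feynman identity
(`hasSum_slope`). So the flux is `i λ' ⟨u, εV⟩` at every `x₁` (`fluxForm_floquetMode`).

With `u = V` the pairing is positive, and the sign of the flux is the sign of `λ'`. For two bands,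
`q` is skew-Hermitian, so evaluating `q(v,ṽ)` from either band gives `λ_m' ⟨u, εV⟩ = λ_n' ⟨u, εV⟩`;
distinct slopes force the pairing to vanish.

The analytic input is that `H2` decay makes the partial Fourier series in `x₁` converge to a `C¹`
curve of traces (`isTraceCurve_floquetMode`). -/

theorem ae_eq_zero_of_forall_integral_exp_mul_eq_zero {a b : ℝ} (hab : a < b) {f : ℝ → ℂ}
    (hf : MemLp f 2 (volume.restrict (Ioc a b)))
    (h : ∀ n : ℤ, ∫ x in a..b,
      Complex.exp (2 * Real.pi * Complex.I * n * x / ((b - a : ℝ) : ℂ)) * f x = 0) :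
    ∀ᵐ x ∂(volume.restrict (Ioc a b)), f x = 0 := by
  have hs := hasSum_sq_fourierCoeffOn hab hf
  have h0 : ∀ i, fourierCoeffOn hab f i = 0 := by
    intro i
    rw [fourierCoeffOn_eq_integral]
    have := h (-i)
    simp only [fourier_coe_apply, smul_eq_mul]
    rw [this, smul_zero]
  simp only [h0, norm_zero, ne_eq, OfNat.ofNat_ne_zero, not_false_eq_true, zero_pow] at hs
  have h1 := hs.unique hasSum_zero
  have h2 : ∫ x in a..b, ‖f x‖ ^ 2 = 0 := by
    rcases smul_eq_zero.1 h1 with h1 | h1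
    · exact absurd h1 (inv_ne_zero (by linarith))
    · exact h1
  rw [intervalIntegral.integral_of_le hab.le] at h2
  have h3 : Integrable (fun x => ‖f x‖ ^ 2) (volume.restrict (Ioc a b)) :=
    (memLp_two_iff_integrable_sq_norm hf.1).1 hf
  have h4 := (integral_eq_zero_iff_of_nonneg (fun x => by positivity) h3).1 h2
  filter_upwards [h4] with x hx
  simpa using hx

theorem memLp_indicator_Ioo {L : ℝ} {f : ℝ → ℂ} (hf : MemLp f 2 (crossMeasure L)) :
    MemLp ((Ioo 0 L).indicator f) 2 volume :=
  (memLp_indicator_iff_restrict measurableSet_Ioo).2 hf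

theorem integrable_bdd_mul_indicator {L : ℝ} {f : ℝ → ℂ} (hf : MemLp f 2 (crossMeasure L))
    {e : ℝ → ℂ} (he : Continuous e) : Integrable (fun x => e x * (Ioo 0 L).indicator f x) := by
  have : (fun x => e x * (Ioo 0 L).indicator f x) = (Ioo 0 L).indicator (fun x => e x * f x) := by
    ext x; by_cases hx : x ∈ Ioo 0 L <;> simp [hx]
  rw [this, integrable_indicator_iff measurableSet_Ioo]
  have hi : IntegrableOn f (Ioo 0 L) := by
    have : IsFiniteMeasure (crossMeasure L) := by unfold crossMeasure; infer_instance
    exact hf.integrable (by norm_num)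
  obtain ⟨C, hC⟩ := (isCompact_Icc (a := (0 : ℝ)) (b := L)).exists_bound_of_continuousOn
    he.continuousOn
  refine Integrable.bdd_mul hi he.aestronglyMeasurable (c := C) ?_
  filter_upwards [ae_restrict_mem measurableSet_Ioo] with x hx
  exact hC x ⟨hx.1.le, hx.2.le⟩

theorem integral_mul_indicator {L : ℝ} (f e : ℝ → ℂ) :
    ∫ x, e x * (Ioo 0 L).indicator f x = ∫ x, e x * f x ∂(crossMeasure L) := by
  have : (fun x => e x * (Ioo 0 L).indicator f x) = (Ioo 0 L).indicator (fun x => e x * f x) := by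
    ext x; by_cases hx : x ∈ Ioo 0 L <;> simp [hx]
  rw [this, integral_indicator measurableSet_Ioo, crossMeasure]

/-- Extend `f` by zero to `g` and apply Fourier completeness on `(-L, L]` to `g(x) + s g(-x)`.
Folding the integral moves the reflection onto the exponential. The values `s = -1` and `s = 1` give
the sine and cosine systems. -/
theorem ae_eq_zero_of_forall_integral_reflected {L : ℝ} (hL : 0 < L) {f : ℝ → ℂ}
    (hf : MemLp f 2 (crossMeasure L)) (s : ℂ)
    (h : ∀ n : ℤ, ∫ x, (Complex.exp (Real.pi * Complex.I * n * x / L)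
      + s * Complex.exp (-(Real.pi * Complex.I * n * x / L))) * f x ∂(crossMeasure L) = 0) :
    ∀ᵐ x ∂(crossMeasure L), f x = 0 := by
  set g := (Ioo 0 L).indicator f with hg
  have hgm : MemLp g 2 volume := memLp_indicator_Ioo hf
  have hgm' : MemLp (fun x => g (-x)) 2 volume :=
    hgm.comp_measurePreserving (Measure.measurePreserving_neg volume)
  have hF : MemLp (fun x => g x + s * g (-x)) 2 volume := hgm.add (hgm'.const_mul s)
  have key := ae_eq_zero_of_forall_integral_exp_mul_eq_zero (a := -L) (b := L) (by linarith)
    (hF.restrict _) (by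
      intro n
      set e : ℝ → ℂ := fun x => Complex.exp (Real.pi * Complex.I * n * x / L) with he
      have hec : Continuous e := by fun_prop
      have h1 : ∀ x : ℝ, Complex.exp (2 * Real.pi * Complex.I * n * x / ((L - -L : ℝ) : ℂ))
          = e x := by
        intro x
        have : (L : ℂ) ≠ 0 := by exact_mod_cast hL.ne'
        simp only [he]
        congr 1
        push_cast
        field_simp
        ring
      simp only [h1]
      rw [intervalIntegral.integral_of_le (by linarith),
        setIntegral_eq_integral_of_forall_compl_eq_zero]
      · have hi1 : Integrable (fun x => e x * g x) := integrable_bdd_mul_indicator hf hec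
        have hi2 : Integrable (fun x => e (-x) * g x) :=
          integrable_bdd_mul_indicator hf (e := fun x => e (-x)) (by fun_prop)
        have hi3 : Integrable (fun x => e x * g (-x)) := by
          have := hi2.comp_neg
          simpa using this
        have h2 : ∫ x, e x * g (-x) = ∫ x, e (-x) * g x := by
          rw [← integral_neg_eq_self]
          simp
        calc ∫ x, e x * (g x + s * g (-x))
            = ∫ x, (e x * g x + s * (e x * g (-x))) := by congr 1; ext x; ring
          _ = (∫ x, e x * g x) + s * ∫ x, e (-x) * g x := by
              rw [integral_add hi1 (hi3.const_mul s), integral_const_mul, h2]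
          _ = ∫ x, (e x + s * e (-x)) * g x := by
              rw [← integral_const_mul, ← integral_add hi1 (hi2.const_mul s)]
              congr 1; ext x; ring
          _ = ∫ x, (e x + s * e (-x)) * f x ∂(crossMeasure L) := integral_mul_indicator _ _
          _ = 0 := by
              rw [← h n]
              congr 1; ext x
              simp only [he]
              congr 4
              push_cast; ring
      · intro x hx
        have h3 : x ∉ Ioo 0 L := fun h' => hx ⟨by linarith [h'.1], h'.2.le⟩
        by_cases h4 : -x ∈ Ioo 0 L
        · exact absurd ⟨by linarith [h4.2], by linarith [h4.1]⟩ hx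
        · simp [hg, h3, h4])
  have key2 : ∀ᵐ x ∂(crossMeasure L), g x + s * g (-x) = 0 :=
    
    ae_restrict_of_ae_restrict_of_subset
      (show Ioo 0 L ⊆ Ioc (-L) L from fun x hx => ⟨by linarith [hx.1], hx.2.le⟩) key
  filter_upwards [key2, ae_restrict_mem measurableSet_Ioo] with x hx hx2
  have h4 : -x ∉ Ioo 0 L := fun h' => by linarith [h'.1, hx2.1]
  simpa [hg, hx2, h4] using hx

theorem ae_eq_zero_of_forall_integral_sin_mul_eq_zero {L : ℝ} (hL : 0 < L) {f : ℝ → ℂ}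
    (hf : MemLp f 2 (crossMeasure L))
    (h : ∀ n : ℤ, 1 ≤ n → ∫ x, (Real.sin (Real.pi * n / L * x) : ℂ) * f x ∂(crossMeasure L) = 0) :
    ∀ᵐ x ∂(crossMeasure L), f x = 0 := by
  refine ae_eq_zero_of_forall_integral_reflected hL hf (-1) fun n => ?_
  have h0 : ∀ n : ℤ, ∫ x, (Real.sin (Real.pi * n / L * x) : ℂ) * f x ∂(crossMeasure L) = 0 := by
    intro n
    rcases lt_trichotomy n 0 with hn | rfl | hn
    · have := h (-n) (by omega)
      have h2 : ∀ x : ℝ, (Real.sin (Real.pi * n / L * x) : ℂ) * f x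
          = -((Real.sin (Real.pi * (-n : ℤ) / L * x) : ℂ) * f x) := by
        intro x
        have : Real.pi * (-n : ℤ) / L * x = -(Real.pi * n / L * x) := by push_cast; ring
        rw [this, Real.sin_neg]; push_cast; ring
      simp_rw [h2]
      rw [integral_neg, this, neg_zero]
    · simp
    · exact h n hn
  have h1 : ∀ x : ℝ, (Complex.exp (Real.pi * Complex.I * n * x / L)
      + -1 * Complex.exp (-(Real.pi * Complex.I * n * x / L))) * f x
      = 2 * Complex.I * ((Real.sin (Real.pi * n / L * x) : ℂ) * f x) := by
    intro x
    have e1 : (Real.pi * Complex.I * n * x / L : ℂ) = (Real.pi * n / L * x : ℝ) * Complex.I := by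
      push_cast; ring
    rw [e1, ← neg_mul, Complex.ofReal_sin, Complex.sin]
    linear_combination (-(Complex.exp (-((Real.pi * n / L * x : ℝ) : ℂ) * Complex.I)
      - Complex.exp (((Real.pi * n / L * x : ℝ) : ℂ) * Complex.I)) * f x) * Complex.I_mul_I
  simp_rw [h1]
  rw [integral_const_mul, h0 n, mul_zero]

theorem ae_eq_zero_of_forall_integral_cos_mul_eq_zero {L : ℝ} (hL : 0 < L) {f : ℝ → ℂ}
    (hf : MemLp f 2 (crossMeasure L))
    (h : ∀ n : ℤ, 0 ≤ n → ∫ x, (Real.cos (Real.pi * n / L * x) : ℂ) * f x ∂(crossMeasure L) = 0) :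
    ∀ᵐ x ∂(crossMeasure L), f x = 0 := by
  refine ae_eq_zero_of_forall_integral_reflected hL hf 1 fun n => ?_
  have h0 : ∀ n : ℤ, ∫ x, (Real.cos (Real.pi * n / L * x) : ℂ) * f x ∂(crossMeasure L) = 0 := by
    intro n
    rcases lt_or_ge n 0 with hn | hn
    · rw [← h (-n) (by omega)]
      congr 1; ext x
      have : Real.pi * (-n : ℤ) / L * x = -(Real.pi * n / L * x) := by push_cast; ring
      rw [this, Real.cos_neg]
    · exact h n hn
  have h1 : ∀ x : ℝ, (Complex.exp (Real.pi * Complex.I * n * x / L)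
      + 1 * Complex.exp (-(Real.pi * Complex.I * n * x / L))) * f x
      = 2 * ((Real.cos (Real.pi * n / L * x) : ℂ) * f x) := by
    intro x
    have e1 : (Real.pi * Complex.I * n * x / L : ℂ) = (Real.pi * n / L * x : ℝ) * Complex.I := by
      push_cast; ring
    rw [e1, ← neg_mul, Complex.ofReal_cos, Complex.cos]
    ring
  simp_rw [h1]
  rw [integral_const_mul, h0 n, mul_zero]

/-- Reflecting `f` at `L` reduces the claim to the full sine system on `(0, 2L)`: sines of even
index are odd about `L` and integrate to zero against the extension, while those of odd index are
even about `L` and give twice the assumed integrals. -/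
theorem ae_eq_zero_of_forall_integral_sin_odd_mul_eq_zero {L : ℝ} (hL : 0 < L) {f : ℝ → ℂ}
    (hf : MemLp f 2 (crossMeasure L))
    (h : ∀ n : ℤ, 1 ≤ n →
      ∫ x, (Real.sin (Real.pi * (2 * n - 1) / (2 * L) * x) : ℂ) * f x ∂(crossMeasure L) = 0) :
    ∀ᵐ x ∂(crossMeasure L), f x = 0 := by
  set g := (Ioo 0 L).indicator f with hg
  have hgm : MemLp g 2 volume := memLp_indicator_Ioo hf
  have hgm' : MemLp (fun x => g (2 * L - x)) 2 volume :=
    hgm.comp_measurePreserving (Measure.measurePreserving_sub_left volume (2 * L))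
  have hF : MemLp (fun x => g x + g (2 * L - x)) 2 volume := hgm.add hgm'
  have key := ae_eq_zero_of_forall_integral_sin_mul_eq_zero (L := 2 * L) (by linarith)
    (f := fun x => g x + g (2 * L - x)) (hF.restrict _) (by
      intro n hn
      set e : ℝ → ℂ := fun x => (Real.sin (Real.pi * n / (2 * L) * x) : ℂ) with he
      have hec : Continuous e := by fun_prop
      rw [← integral_mul_indicator]
      have h0 : ∀ᵐ x : ℝ, e x * (Ioo 0 (2 * L)).indicator (fun x => g x + g (2 * L - x)) x
          = e x * g x + e x * g (2 * L - x) := by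
        refine Eventually.of_forall fun x => ?_
        by_cases hx : x ∈ Ioo 0 (2 * L)
        · simp [hx, mul_add]
        · have h1 : x ∉ Ioo 0 L := fun h' => hx ⟨h'.1, by linarith [h'.2]⟩
          have h2 : 2 * L - x ∉ Ioo 0 L := fun h' => hx ⟨by linarith [h'.2], by linarith [h'.1]⟩
          simp [hx, hg, h1, h2]
      rw [integral_congr_ae h0]
      have hi1 : Integrable (fun x => e x * g x) := integrable_bdd_mul_indicator hf hec
      have hi2 : Integrable (fun x => e (2 * L - x) * g x) :=
        integrable_bdd_mul_indicator hf (e := fun x => e (2 * L - x)) (by fun_prop)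
      have hi3 : Integrable (fun x => e x * g (2 * L - x)) := by
        have := hi2.comp_sub_left (2 * L)
        simpa using this
      have h2 : ∫ x, e x * g (2 * L - x) = ∫ x, e (2 * L - x) * g x := by
        rw [← integral_sub_left_eq_self _ volume (2 * L)]
        simp
      rw [integral_add hi1 hi3, h2, ← integral_add hi1 hi2]
      have h3 : ∀ x : ℝ, e (2 * L - x) = -((-1 : ℝ) ^ n : ℝ) * e x := by
        intro x
        have h4 : Real.pi * n / (2 * L) * (2 * L - x)
            = n * Real.pi - Real.pi * n / (2 * L) * x := by field_simp
        simp only [he]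
        rw [h4, Real.sin_int_mul_pi_sub]
        push_cast; ring
      have h4 : ∀ x : ℝ, e x * g x + e (2 * L - x) * g x
          = (1 - ((-1 : ℝ) ^ n : ℝ)) * (e x * g x) := by
        intro x; rw [h3]; push_cast; ring
      simp_rw [h4]
      rw [integral_const_mul, integral_mul_indicator]
      rcases Int.even_or_odd' n with ⟨k, rfl | rfl⟩
      · have : (-1 : ℝ) ^ (2 * k) = 1 := by rw [zpow_mul]; norm_num
        rw [this]; simp
      · have := h (k + 1) (by omega)
        have h5 : ∫ x, e x * f x ∂(crossMeasure L) = 0 := by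
          rw [← this]
          congr 1; ext x
          simp only [he]
          push_cast
          congr 4
          ring
        rw [h5, mul_zero])
  have key2 : ∀ᵐ x ∂(crossMeasure L), g x + g (2 * L - x) = 0 :=
    
    ae_restrict_of_ae_restrict_of_subset
      (show Ioo 0 L ⊆ Ioo 0 (2 * L) from fun x hx => ⟨hx.1, by linarith [hx.2]⟩) key
  filter_upwards [key2, ae_restrict_mem measurableSet_Ioo] with x hx hx2
  have h4 : 2 * L - x ∉ Ioo 0 L := fun h' => by linarith [h'.2, hx2.2]
  simpa [hg, hx2, h4] using hx

/-- The unimodular factor `e^{-iβx/L}` removes the quasi-periodicity. -/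
theorem ae_eq_zero_of_forall_integral_exp_shift_mul_eq_zero {L : ℝ} (hL : 0 < L) (β : ℝ)
    {f : ℝ → ℂ} (hf : MemLp f 2 (crossMeasure L))
    (h : ∀ n : ℤ, ∫ x, Complex.exp (-(Complex.I * ((β + 2 * Real.pi * n) / L : ℝ) * x)) * f x
      ∂(crossMeasure L) = 0) :
    ∀ᵐ x ∂(crossMeasure L), f x = 0 := by
  set e : ℝ → ℂ := fun x => Complex.exp (-(Complex.I * β * x / L)) with he
  have hec : Continuous e := by fun_prop
  have hnorm : ∀ x, ‖e x‖ = 1 := by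
    intro x
    have : (-(Complex.I * β * x / L) : ℂ) = (-(β * x / L) : ℝ) * Complex.I := by push_cast; ring
    simp only [he]
    rw [this, Complex.norm_exp_ofReal_mul_I]
  have hF : MemLp (fun x => e x * f x) 2 (crossMeasure L) :=
    hf.of_le_mul (c := 1) (hec.aestronglyMeasurable.mul hf.1)
      (Eventually.of_forall fun x => by simp [hnorm x])
  have hr : (volume : Measure ℝ).restrict (Ioc 0 L) = crossMeasure L :=
    (Measure.restrict_congr_set Ioo_ae_eq_Ioc).symm
  have key := ae_eq_zero_of_forall_integral_exp_mul_eq_zero hL (f := fun x => e x * f x)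
    (by rw [hr]; exact hF) (by
      intro n
      rw [intervalIntegral.integral_of_le hL.le, hr, ← h (-n)]
      congr 1; ext x
      simp only [he]
      rw [← mul_assoc, ← Complex.exp_add]
      congr 2
      push_cast
      have : (L : ℂ) ≠ 0 := by exact_mod_cast hL.ne'
      field_simp
      ring)
  rw [hr] at key
  filter_upwards [key] with x hx
  rcases mul_eq_zero.1 hx with h1 | h1
  · exact absurd h1 (Complex.exp_ne_zero _)
  · exact h1

/-! ### The Hilbert basis of the cross section -/

instance crossMeasure.instIsFiniteMeasure (L : ℝ) : IsFiniteMeasure (crossMeasure L) := by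
  unfold crossMeasure; infer_instance

theorem contDiff_eigenfun (L : ℝ) (γ : LateralBC) (k : ℤ) : ContDiff ℝ ∞ (γ.eigenfun L k) := by
  have h : ContDiff ℝ ∞ (fun t : ℝ => (t : ℂ)) := Complex.ofRealCLM.contDiff
  cases γ with
  | dirichlet =>
    exact h.comp (f := fun t => √(2 / L) * Real.sin (LateralBC.freq L .dirichlet k * t))
      (by fun_prop)
  | neumann =>
    exact h.comp (f := fun t => (if k = 0 then √(1 / L) else √(2 / L))
      * Real.cos (LateralBC.freq L .neumann k * t)) (by fun_prop)
  | mixed =>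
    exact h.comp (f := fun t => √(2 / L) * Real.sin (LateralBC.freq L .mixed k * t)) (by fun_prop)
  | quasiPeriodic β =>
    exact contDiff_const.mul (contDiff_const.mul h).cexp

theorem memLp_crossMeasure_of_continuous {L : ℝ} {f : ℝ → ℂ} (hf : Continuous f) (p : ℝ≥0∞) :
    MemLp f p (crossMeasure L) := by
  obtain ⟨C, hC⟩ := (isCompact_Icc (a := (0 : ℝ)) (b := L)).exists_bound_of_continuousOn
    hf.continuousOn
  refine MemLp.of_bound hf.aestronglyMeasurable C ?_
  filter_upwards [ae_restrict_mem measurableSet_Ioo] with x hx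
  exact hC x ⟨hx.1.le, hx.2.le⟩

theorem memLp_eigenfun (L : ℝ) (γ : LateralBC) (k : ℤ) :
    MemLp (γ.eigenfun L k) 2 (crossMeasure L) :=
  memLp_crossMeasure_of_continuous (contDiff_eigenfun L γ k).continuous 2

/-- The eigenfunction `ψ_k` as an element of `L²((0, L))`. -/
def eigenLp (L : ℝ) (γ : LateralBC) (k : ℤ) : CrossL2 L := (memLp_eigenfun L γ k).toLp _

theorem coeFn_eigenLp (L : ℝ) (γ : LateralBC) (k : ℤ) :
    (eigenLp L γ k : ℝ → ℂ) =ᵐ[crossMeasure L] γ.eigenfun L k := MemLp.coeFn_toLp _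

theorem inner_eigenLp (L : ℝ) (γ : LateralBC) (k : ℤ) (f : CrossL2 L) :
    ⟪eigenLp L γ k, f⟫_ℂ = ∫ x, f x * conj (γ.eigenfun L k x) ∂(crossMeasure L) := by
  rw [L2.inner_def]
  refine integral_congr_ae ?_
  filter_upwards [coeFn_eigenLp L γ k] with x hx
  rw [hx, RCLike.inner_apply]

theorem integral_cos_crossMeasure {L : ℝ} (hL : 0 < L) (p : ℤ) :
    ∫ x, Real.cos (Real.pi * p / L * x) ∂(crossMeasure L) = if p = 0 then L else 0 := by
  have hr : crossMeasure L = (volume : Measure ℝ).restrict (Ioc 0 L) :=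
    Measure.restrict_congr_set Ioo_ae_eq_Ioc
  rw [hr, ← intervalIntegral.integral_of_le hL.le]
  split_ifs with hp
  · simp [hp]
  · have hc : Real.pi * p / L ≠ 0 := by
      have : (p : ℝ) ≠ 0 := by exact_mod_cast hp
      have := Real.pi_ne_zero
      positivity
    rw [intervalIntegral.integral_comp_mul_left _ hc, integral_cos]
    have : Real.pi * p / L * L = p * Real.pi := by field_simp
    rw [this, Real.sin_int_mul_pi]
    simp

theorem integrable_crossMeasure_of_continuous {L : ℝ} {E : Type*} [NormedAddCommGroup E]
    {f : ℝ → E} (hf : Continuous f) : Integrable f (crossMeasure L) :=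
  (hf.integrableOn_Icc (a := 0) (b := L)).mono_set Ioo_subset_Icc_self

theorem integral_cos_mul_cos_crossMeasure {L : ℝ} (hL : 0 < L) (p q : ℤ) :
    ∫ x, Real.cos (Real.pi * p / L * x) * Real.cos (Real.pi * q / L * x) ∂(crossMeasure L)
      = ((if p - q = 0 then L else 0) + if p + q = 0 then L else 0) / 2 := by
  rw [← integral_cos_crossMeasure hL, ← integral_cos_crossMeasure hL, ← integral_add,
    ← integral_div]
  · congr 1; ext x
    have h1 : Real.pi * (p - q : ℤ) / L * x = Real.pi * p / L * x - Real.pi * q / L * x := by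
      push_cast; ring
    have h2 : Real.pi * (p + q : ℤ) / L * x = Real.pi * p / L * x + Real.pi * q / L * x := by
      push_cast; ring
    rw [h1, h2, Real.cos_add, Real.cos_sub]; ring
  all_goals exact integrable_crossMeasure_of_continuous (by fun_prop)

/-- Only the sum and difference of the frequencies must be multiples of `π / L`, so the half-integer
frequencies of the mixed condition are covered too. -/
theorem integral_sin_mul_sin_crossMeasure {L : ℝ} (hL : 0 < L) {a b : ℝ} {p q : ℤ}
    (hp : a - b = Real.pi * p / L) (hq : a + b = Real.pi * q / L) :
    ∫ x, Real.sin (a * x) * Real.sin (b * x) ∂(crossMeasure L)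
      = ((if p = 0 then L else 0) - if q = 0 then L else 0) / 2 := by
  rw [← integral_cos_crossMeasure hL, ← integral_cos_crossMeasure hL, ← integral_sub,
    ← integral_div]
  · congr 1; ext x
    have h1 : Real.pi * p / L * x = a * x - b * x := by rw [← hp]; ring
    have h2 : Real.pi * q / L * x = a * x + b * x := by rw [← hq]; ring
    rw [h1, h2, Real.cos_add, Real.cos_sub]; ring
  all_goals exact integrable_crossMeasure_of_continuous (by fun_prop)

/-- For the real systems, product-to-sum formulas apply. The one-sided index set keeps the sum
frequency nonzero except for the constant Neumann mode, which has its own normalisation. In the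
quasi-periodic case `β` cancels. -/
theorem integral_eigenfun_mul_conj {L : ℝ} (hL : 0 < L) (γ : LateralBC) (i j : γ.index) :
    ∫ x, γ.eigenfun L j x * conj (γ.eigenfun L i x) ∂(crossMeasure L) = if i = j then 1 else 0 := by
  have hs : √(2 / L) * √(2 / L) = 2 / L := Real.mul_self_sqrt (by positivity)
  have hs1 : √(1 / L) * √(1 / L) = 1 / L := Real.mul_self_sqrt (by positivity)
  obtain ⟨i, hi⟩ := i
  obtain ⟨j, hj⟩ := j
  simp only [Subtype.mk.injEq]
  cases γ with
  | dirichlet =>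
    simp only [LateralBC.index, mem_ofPred_eq] at hi hj
    simp only [LateralBC.eigenfun, Complex.conj_ofReal, ← Complex.ofReal_mul, LateralBC.freq]
    rw [integral_complex_ofReal]
    have h1 : ∀ x, √(2 / L) * Real.sin (Real.pi * j / L * x)
        * (√(2 / L) * Real.sin (Real.pi * i / L * x))
        = 2 / L * (Real.sin (Real.pi * j / L * x) * Real.sin (Real.pi * i / L * x)) := by
      intro x
      linear_combination (Real.sin (Real.pi * j / L * x) * Real.sin (Real.pi * i / L * x)) * hs
    simp_rw [h1]
    rw [integral_const_mul, integral_sin_mul_sin_crossMeasure hL (p := j - i) (q := j + i)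
      (by push_cast; ring) (by push_cast; ring), if_neg (show j + i ≠ 0 by omega)]
    by_cases h : i = j
    · subst h; simp [hL.ne']
    · rw [if_neg (by omega), if_neg h]; simp
  | neumann =>
    simp only [LateralBC.index, mem_ofPred_eq] at hi hj
    simp only [LateralBC.eigenfun, Complex.conj_ofReal, ← Complex.ofReal_mul, LateralBC.freq]
    rw [integral_complex_ofReal]
    have h1 : ∀ x (a b : ℝ), a * Real.cos (Real.pi * j / L * x)
        * (b * Real.cos (Real.pi * i / L * x))
        = a * b * (Real.cos (Real.pi * j / L * x) * Real.cos (Real.pi * i / L * x)) := by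
      intros; ring
    simp_rw [h1]
    rw [integral_const_mul, integral_cos_mul_cos_crossMeasure hL]
    by_cases h : i = j
    · subst h
      by_cases h0 : i = 0
      · subst h0; simp only [if_true]; rw [hs1]; simp [hL.ne']
      · rw [if_neg h0, hs, if_neg (show i + i ≠ 0 by omega)]; simp [hL.ne']
    · rw [if_neg (show j - i ≠ 0 by omega), if_neg (show j + i ≠ 0 by omega), if_neg h]; simp
  | mixed =>
    simp only [LateralBC.index, mem_ofPred_eq] at hi hj
    simp only [LateralBC.eigenfun, Complex.conj_ofReal, ← Complex.ofReal_mul, LateralBC.freq]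
    rw [integral_complex_ofReal]
    have h1 : ∀ x, √(2 / L) * Real.sin (Real.pi * (2 * j - 1) / (2 * L) * x)
        * (√(2 / L) * Real.sin (Real.pi * (2 * i - 1) / (2 * L) * x))
        = 2 / L * (Real.sin (Real.pi * (2 * j - 1) / (2 * L) * x)
          * Real.sin (Real.pi * (2 * i - 1) / (2 * L) * x)) := by
      intro x; linear_combination (Real.sin (Real.pi * (2 * j - 1) / (2 * L) * x)
        * Real.sin (Real.pi * (2 * i - 1) / (2 * L) * x)) * hs
    simp_rw [h1]
    rw [integral_const_mul, integral_sin_mul_sin_crossMeasure hL (p := j - i) (q := j + i - 1)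
      (by push_cast; field_simp; ring) (by push_cast; field_simp; ring),
      if_neg (show j + i - 1 ≠ 0 by omega)]
    by_cases h : i = j
    · subst h; simp [hL.ne']
    · rw [if_neg (by omega), if_neg h]; simp
  | quasiPeriodic β =>
    simp only [LateralBC.eigenfun, LateralBC.freq, map_mul, Complex.conj_ofReal, ← Complex.exp_conj,
      Complex.conj_I]
    have hs2 : (√(1 / L) : ℂ) * (√(1 / L) : ℂ) = 1 / L := by
      rw [← Complex.ofReal_mul, hs1]; push_cast; rfl
    have hLc : (L : ℂ) ≠ 0 := by exact_mod_cast hL.ne'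
    have h1 : ∀ x : ℝ, (√(1 / L) : ℂ)
          * Complex.exp (Complex.I * (((β + 2 * Real.pi * j) / L : ℝ) : ℂ) * x)
        * ((√(1 / L) : ℂ) * Complex.exp (-Complex.I * (((β + 2 * Real.pi * i) / L : ℝ) : ℂ) * x))
        = 1 / L * Complex.exp ((2 * Real.pi * (j - i) / L * Complex.I) * x) := by
      intro x
      rw [← hs2, mul_mul_mul_comm, ← Complex.exp_add]
      congr 2
      push_cast; field_simp; ring
    simp_rw [h1]
    have hr : crossMeasure L = (volume : Measure ℝ).restrict (Ioc 0 L) :=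
      Measure.restrict_congr_set Ioo_ae_eq_Ioc
    rw [integral_const_mul, hr, ← intervalIntegral.integral_of_le hL.le]
    by_cases h : i = j
    · subst h; simp [hLc]
    · rw [if_neg h, integral_exp_mul_complex]
      · have h2 : (2 * Real.pi * (j - i) / L * Complex.I * (L : ℝ) : ℂ)
            = (j - i : ℤ) * (2 * Real.pi * Complex.I) := by push_cast; field_simp
        rw [h2, Complex.exp_int_mul_two_pi_mul_I]
        simp
      · have : ((j : ℂ) - i) ≠ 0 := by
          rw [sub_ne_zero]; exact_mod_cast Ne.symm h
        have hpi : (Real.pi : ℂ) ≠ 0 := by exact_mod_cast Real.pi_ne_zero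
        simp [this, hpi, hLc]

theorem orthonormal_eigenLp {L : ℝ} (hL : 0 < L) (γ : LateralBC) :
    Orthonormal ℂ fun j : γ.index => eigenLp L γ j := by
  classical
  rw [orthonormal_iff_ite]
  intro i j
  rw [inner_eigenLp, ← integral_eigenfun_mul_conj hL γ i j]
  refine integral_congr_ae ?_
  filter_upwards [coeFn_eigenLp L γ j] with x hx
  rw [hx]

theorem ae_eq_zero_of_forall_integral_eigenfun {L : ℝ} (hL : 0 < L) (γ : LateralBC) {f : ℝ → ℂ}
    (hf : MemLp f 2 (crossMeasure L))
    (h : ∀ j : γ.index, ∫ x, f x * conj (γ.eigenfun L j x) ∂(crossMeasure L) = 0) :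
    ∀ᵐ x ∂(crossMeasure L), f x = 0 := by
  have hs : (√(2 / L) : ℂ) ≠ 0 := by
    exact_mod_cast (Real.sqrt_pos.2 (by positivity : 0 < 2 / L)).ne'
  have hs1 : (√(1 / L) : ℂ) ≠ 0 := by
    exact_mod_cast (Real.sqrt_pos.2 (by positivity : 0 < 1 / L)).ne'
  cases γ with
  | dirichlet =>
    refine ae_eq_zero_of_forall_integral_sin_mul_eq_zero hL hf fun n hn => ?_
    have := h ⟨n, hn⟩
    simp only [LateralBC.eigenfun, LateralBC.freq, Complex.conj_ofReal] at this
    refine (mul_eq_zero.1 ?_).resolve_left hs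
    rw [← this, ← integral_const_mul]
    congr 1; ext x; push_cast; ring
  | neumann =>
    refine ae_eq_zero_of_forall_integral_cos_mul_eq_zero hL hf fun n hn => ?_
    have := h ⟨n, hn⟩
    simp only [LateralBC.eigenfun, LateralBC.freq, Complex.conj_ofReal] at this
    refine (mul_eq_zero.1 (?_ : ((if n = 0 then √(1 / L) else √(2 / L) : ℝ) : ℂ) * _ = 0)
      ).resolve_left (by split_ifs <;> assumption)
    rw [← this, ← integral_const_mul]
    congr 1; ext x; push_cast; ring
  | mixed =>
    refine ae_eq_zero_of_forall_integral_sin_odd_mul_eq_zero hL hf fun n hn => ?_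
    have := h ⟨n, hn⟩
    simp only [LateralBC.eigenfun, LateralBC.freq, Complex.conj_ofReal] at this
    refine (mul_eq_zero.1 ?_).resolve_left hs
    rw [← this, ← integral_const_mul]
    congr 1; ext x; push_cast; ring
  | quasiPeriodic β =>
    refine ae_eq_zero_of_forall_integral_exp_shift_mul_eq_zero hL β hf fun n => ?_
    have := h ⟨n, mem_univ _⟩
    simp only [LateralBC.eigenfun, LateralBC.freq, map_mul, Complex.conj_ofReal,
      ← Complex.exp_conj, Complex.conj_I] at this
    refine (mul_eq_zero.1 ?_).resolve_left hs1
    rw [← this, ← integral_const_mul]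
    congr 1; ext x
    rw [neg_mul, neg_mul]
    ring

/-- The eigenfunctions of the cross section form a Hilbert basis of `L²((0, L))`. -/
def crossBasis {L : ℝ} (hL : 0 < L) (γ : LateralBC) : HilbertBasis γ.index ℂ (CrossL2 L) :=
  HilbertBasis.mkOfOrthogonalEqBot (orthonormal_eigenLp hL γ) <| by
    rw [Submodule.eq_bot_iff]
    intro f hf
    rw [Submodule.mem_orthogonal] at hf
    have h := ae_eq_zero_of_forall_integral_eigenfun hL γ (Lp.memLp f) fun j => by
      rw [← inner_eigenLp]
      exact hf _ (Submodule.subset_span ⟨j, rfl⟩)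
    exact (Lp.eq_zero_iff_ae_eq_zero).2 h

theorem crossBasis_apply {L : ℝ} (hL : 0 < L) (γ : LateralBC) (j : γ.index) :
    crossBasis hL γ j = eigenLp L γ j := by
  rw [crossBasis, HilbertBasis.coe_mkOfOrthogonalEqBot]

/-! ### Tensor products of square integrable functions -/

theorem integral_eq_integral_comp {α β : Type*} [MeasurableSpace α] [MeasurableSpace β]
    {μ : Measure α} {ν : Measure β} {φ : α → β} (hφ : MeasurePreserving φ μ ν) {f : β → ℂ}
    (hf : AEStronglyMeasurable f ν) : ∫ y, f y ∂ν = ∫ x, f (φ x) ∂μ := by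
  rw [← hφ.map_eq] at hf ⊢
  exact integral_map hφ.measurable.aemeasurable hf

section Tensor

variable {α β : Type*} [MeasurableSpace α] [MeasurableSpace β] {μ : Measure α} {ν : Measure β}

theorem ae_prod_fst {p : α → Prop} (h : ∀ᵐ x ∂μ, p x) : ∀ᵐ x ∂(μ.prod ν), p x.1 :=
  Measure.quasiMeasurePreserving_fst.ae h

theorem ae_prod_snd {p : β → Prop} (h : ∀ᵐ x ∂ν, p x) : ∀ᵐ x ∂(μ.prod ν), p x.2 :=
  Measure.quasiMeasurePreserving_snd.ae h

variable [IsFiniteMeasure μ] [IsFiniteMeasure ν]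

theorem memLp_two_mul_prod {f : α → ℂ} {g : β → ℂ} (hf : MemLp f 2 μ) (hg : MemLp g 2 ν) :
    MemLp (fun x : α × β => f x.1 * g x.2) 2 (μ.prod ν) := by
  have hm : AEStronglyMeasurable (fun x : α × β => f x.1 * g x.2) (μ.prod ν) :=
    (hf.comp_fst ν).1.mul (hg.comp_snd μ).1
  rw [memLp_two_iff_integrable_sq_norm hm]
  simp only [norm_mul, mul_pow]
  exact ((memLp_two_iff_integrable_sq_norm hf.1).1 hf).mul_prod
    ((memLp_two_iff_integrable_sq_norm hg.1).1 hg)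

/-- The product function `(x, y) ↦ f x * g y` in `L²(μ × ν)`. -/
def tensorLp (f : Lp ℂ 2 μ) (g : Lp ℂ 2 ν) : Lp ℂ 2 (μ.prod ν) :=
  (memLp_two_mul_prod (Lp.memLp f) (Lp.memLp g)).toLp _

theorem coeFn_tensorLp (f : Lp ℂ 2 μ) (g : Lp ℂ 2 ν) :
    (tensorLp f g : α × β → ℂ) =ᵐ[μ.prod ν] fun x => f x.1 * g x.2 := MemLp.coeFn_toLp _

theorem inner_tensorLp (f f' : Lp ℂ 2 μ) (g g' : Lp ℂ 2 ν) :
    ⟪tensorLp f g, tensorLp f' g'⟫_ℂ = ⟪f, f'⟫_ℂ * ⟪g, g'⟫_ℂ := by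
  simp only [L2.inner_def]
  rw [← integral_prod_mul]
  refine integral_congr_ae ?_
  filter_upwards [coeFn_tensorLp f g, coeFn_tensorLp f' g'] with x hx hx'
  rw [hx, hx']
  simp only [RCLike.inner_apply, map_mul]
  ring

theorem norm_tensorLp (f : Lp ℂ 2 μ) (g : Lp ℂ 2 ν) : ‖tensorLp f g‖ = ‖f‖ * ‖g‖ := by
  have h := inner_tensorLp f f g g
  simp only [inner_self_eq_norm_sq_to_K] at h
  have h2 : ‖tensorLp f g‖ ^ 2 = (‖f‖ * ‖g‖) ^ 2 := by
    rw [mul_pow]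
    exact_mod_cast h
  exact (pow_left_inj₀ (norm_nonneg _) (by positivity) two_ne_zero).1 h2

theorem tensorLp_add_left (f f' : Lp ℂ 2 μ) (g : Lp ℂ 2 ν) :
    tensorLp (f + f') g = tensorLp f g + tensorLp f' g := by
  refine Lp.ext ?_
  filter_upwards [coeFn_tensorLp f g, coeFn_tensorLp f' g, coeFn_tensorLp (f + f') g,
    Lp.coeFn_add (tensorLp f g) (tensorLp f' g), ae_prod_fst (ν := ν) (Lp.coeFn_add f f')]
    with x h1 h2 h3 h4 h5
  rw [h3, h4, Pi.add_apply, h1, h2, h5, Pi.add_apply, add_mul]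

theorem tensorLp_add_right (f : Lp ℂ 2 μ) (g g' : Lp ℂ 2 ν) :
    tensorLp f (g + g') = tensorLp f g + tensorLp f g' := by
  refine Lp.ext ?_
  filter_upwards [coeFn_tensorLp f g, coeFn_tensorLp f g', coeFn_tensorLp f (g + g'),
    Lp.coeFn_add (tensorLp f g) (tensorLp f g'), ae_prod_snd (μ := μ) (Lp.coeFn_add g g')]
    with x h1 h2 h3 h4 h5
  rw [h3, h4, Pi.add_apply, h1, h2, h5, Pi.add_apply, mul_add]

theorem tensorLp_smul_left (c : ℂ) (f : Lp ℂ 2 μ) (g : Lp ℂ 2 ν) :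
    tensorLp (c • f) g = c • tensorLp f g := by
  refine Lp.ext ?_
  filter_upwards [coeFn_tensorLp f g, coeFn_tensorLp (c • f) g,
    Lp.coeFn_smul c (tensorLp f g), ae_prod_fst (ν := ν) (Lp.coeFn_smul c f)] with x h1 h2 h3 h4
  rw [h2, h3, Pi.smul_apply, h1, h4, Pi.smul_apply, smul_eq_mul, smul_eq_mul, mul_assoc]

theorem tensorLp_smul_right (c : ℂ) (f : Lp ℂ 2 μ) (g : Lp ℂ 2 ν) :
    tensorLp f (c • g) = c • tensorLp f g := by
  refine Lp.ext ?_
  filter_upwards [coeFn_tensorLp f g, coeFn_tensorLp f (c • g),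
    Lp.coeFn_smul c (tensorLp f g), ae_prod_snd (μ := μ) (Lp.coeFn_smul c g)] with x h1 h2 h3 h4
  rw [h2, h3, Pi.smul_apply, h1, h4, Pi.smul_apply, smul_eq_mul, smul_eq_mul, mul_left_comm]

variable (μ ν) in
/-- The product of square integrable functions as a continuous bilinear map. -/
def tensorL : Lp ℂ 2 μ →L[ℂ] Lp ℂ 2 ν →L[ℂ] Lp ℂ 2 (μ.prod ν) :=
  LinearMap.mkContinuous₂
    (LinearMap.mk₂ ℂ tensorLp tensorLp_add_left tensorLp_smul_left tensorLp_add_right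
      tensorLp_smul_right) 1 fun f g => by rw [LinearMap.mk₂_apply, norm_tensorLp, one_mul]

theorem tensorL_apply (f : Lp ℂ 2 μ) (g : Lp ℂ 2 ν) : tensorL μ ν f g = tensorLp f g := rfl

/-- Dynkin's π-λ argument: rectangles form a π-system generating the product σ-algebra. -/
theorem ae_eq_zero_of_forall_setIntegral_prod {u : α × β → ℂ} (hu : Integrable u (μ.prod ν))
    (h : ∀ s t, MeasurableSet s → MeasurableSet t → ∫ x in s ×ˢ t, u x ∂(μ.prod ν) = 0) :
    u =ᵐ[μ.prod ν] 0 := by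
  refine hu.ae_eq_zero_of_forall_setIntegral_eq_zero fun s hs _ => ?_
  induction s, hs using MeasurableSpace.induction_on_inter generateFrom_prod.symm
    isPiSystem_prod with
  | empty => simp
  | basic t ht =>
    obtain ⟨a, ha, b, hb, rfl⟩ := ht
    exact h a b ha hb
  | compl t ht ih =>
    have h1 := integral_add_compl ht hu
    have h2 := h univ univ .univ .univ
    rw [univ_prod_univ, setIntegral_univ] at h2
    rwa [h2, ih (measure_lt_top _ _), zero_add] at h1
  | iUnion f hd hf ih =>
    rw [integral_iUnion hf hd hu.integrableOn]
    simp [fun i => ih i (measure_lt_top _ _)]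

theorem eq_zero_of_forall_inner_tensorLp {u : Lp ℂ 2 (μ.prod ν)}
    (h : ∀ f g, ⟪tensorLp f g, u⟫_ℂ = 0) : u = 0 := by
  rw [Lp.eq_zero_iff_ae_eq_zero]
  refine ae_eq_zero_of_forall_setIntegral_prod ((Lp.memLp u).integrable (by norm_num))
    fun s t hs ht => ?_
  rw [← h (indicatorConstLp 2 hs (measure_ne_top _ _) 1)
    (indicatorConstLp 2 ht (measure_ne_top _ _) 1), L2.inner_def, ← integral_indicator (hs.prod ht)]
  refine integral_congr_ae ?_
  filter_upwards [coeFn_tensorLp (indicatorConstLp 2 hs (measure_ne_top μ s) (1 : ℂ))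
    (indicatorConstLp 2 ht (measure_ne_top ν t) 1),
    ae_prod_fst (ν := ν) (indicatorConstLp_coeFn (p := 2) (hs := hs) (hμs := measure_ne_top μ s)
      (c := (1 : ℂ))),
    ae_prod_snd (μ := μ) (indicatorConstLp_coeFn (p := 2) (hs := ht) (hμs := measure_ne_top ν t)
      (c := (1 : ℂ)))] with x h1 h2 h3
  rw [h1, h2, h3, RCLike.inner_apply]
  by_cases hx1 : x.1 ∈ s <;> by_cases hx2 : x.2 ∈ t <;> simp [indicator, hx1, hx2]

variable {ι κ : Type*}

theorem orthonormal_tensorLp (b : HilbertBasis ι ℂ (Lp ℂ 2 μ)) (c : HilbertBasis κ ℂ (Lp ℂ 2 ν)) :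
    Orthonormal ℂ fun l : ι × κ => tensorLp (b l.1) (c l.2) := by
  classical
  rw [orthonormal_iff_ite]
  rintro ⟨i, j⟩ ⟨i', j'⟩
  rw [inner_tensorLp, orthonormal_iff_ite.1 b.orthonormal, orthonormal_iff_ite.1 c.orthonormal]
  simp only [Prod.mk.injEq, ite_and, mul_ite, mul_one, mul_zero]
  split_ifs <;> rfl

/-- The products of the elements of two Hilbert bases form a Hilbert basis of `L²(μ × ν)`. -/
def tensorBasis (b : HilbertBasis ι ℂ (Lp ℂ 2 μ)) (c : HilbertBasis κ ℂ (Lp ℂ 2 ν)) :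
    HilbertBasis (ι × κ) ℂ (Lp ℂ 2 (μ.prod ν)) :=
  HilbertBasis.mkOfOrthogonalEqBot (orthonormal_tensorLp b c) <| by
    rw [Submodule.eq_bot_iff]
    intro u hu
    rw [Submodule.mem_orthogonal] at hu
    have h0 : ∀ i j, ⟪u, tensorLp (b i) (c j)⟫_ℂ = 0 := fun i j => by
      rw [← inner_conj_symm, hu _ (Submodule.subset_span ⟨(i, j), rfl⟩), map_zero]
    -- Completeness is used one factor at a time: with `b i` fixed, a continuous functional
    -- vanishing on the basis `c` is zero; then the same in the first factor.
    have h1 : ∀ i, (innerSL ℂ u).comp (tensorL μ ν (b i)) = 0 := fun i =>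
      ContinuousLinearMap.ext_on ((Submodule.dense_iff_topologicalClosure_eq_top).2 c.dense_span)
        (by rintro _ ⟨j, rfl⟩; exact h0 i j)
    have h2 : ∀ g, (innerSL ℂ u).comp ((tensorL μ ν).flip g) = 0 := fun g =>
      ContinuousLinearMap.ext_on ((Submodule.dense_iff_topologicalClosure_eq_top).2 b.dense_span)
        (by rintro _ ⟨i, rfl⟩; exact DFunLike.congr_fun (h1 i) g)
    refine eq_zero_of_forall_inner_tensorLp fun f g => ?_
    rw [← inner_conj_symm]
    have : ⟪u, tensorLp f g⟫_ℂ = 0 := DFunLike.congr_fun (h2 g) f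
    rw [this, map_zero]

theorem tensorBasis_apply (b : HilbertBasis ι ℂ (Lp ℂ 2 μ)) (c : HilbertBasis κ ℂ (Lp ℂ 2 ν))
    (l : ι × κ) : tensorBasis b c l = tensorLp (b l.1) (c l.2) := by
  rw [tensorBasis, HilbertBasis.coe_mkOfOrthogonalEqBot]

end Tensor

/-! ### The period cell as a subset of the plane -/

/-- The mode `e^{2πint}`. -/
def expMode (n : ℤ) (t : ℝ) : ℂ := Complex.exp (2 * Real.pi * Complex.I * n * t)

theorem contDiff_expMode (n : ℤ) : ContDiff ℝ ∞ (expMode n) := by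
  have : ContDiff ℝ ∞ (fun t : ℝ => (t : ℂ)) := Complex.ofRealCLM.contDiff
  exact (contDiff_const.mul this).cexp

theorem expMode_eq (n : ℤ) (t : ℝ) :
    expMode n t = Complex.exp ((2 * Real.pi * n * t : ℝ) * Complex.I) := by
  rw [expMode]; congr 1; push_cast; ring

theorem norm_expMode (n : ℤ) (t : ℝ) : ‖expMode n t‖ = 1 := by
  rw [expMode_eq, Complex.norm_exp_ofReal_mul_I]

theorem expMode_add (m n : ℤ) (t : ℝ) : expMode (m + n) t = expMode m t * expMode n t := by
  simp only [expMode]; rw [← Complex.exp_add]; congr 1; push_cast; ring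

theorem conj_expMode (n : ℤ) (t : ℝ) : conj (expMode n t) = expMode (-n) t := by
  simp only [expMode, ← Complex.exp_conj, map_mul, Complex.conj_I, Complex.conj_ofReal, map_intCast]
  congr 1; rw [map_ofNat]; push_cast; ring

theorem expMode_add_one (n : ℤ) (t : ℝ) : expMode n (t + 1) = expMode n t := by
  simp only [expMode]
  rw [Complex.exp_eq_exp_iff_exists_int]
  exact ⟨n, by push_cast; ring⟩

theorem fourier_eq_expMode (n : ℤ) (t : ℝ) : fourier n (t : UnitAddCircle) = expMode n t := by
  rw [fourier_coe_apply, expMode]; simp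

/-- Lets the Fourier basis in `x₁` reuse the cross-sectional results, with `β = 0` and `L = 1`. -/
theorem eigenfun_quasiPeriodic_zero (n : ℤ) :
    (LateralBC.quasiPeriodic 0).eigenfun 1 n = expMode n := by
  ext t
  simp only [LateralBC.eigenfun, LateralBC.freq, expMode, div_one, Real.sqrt_one]
  push_cast
  rw [one_mul]
  congr 1; ring

/-- The mode `e^{2πint}` as an element of `L²((0, 1))`. -/
def expLp (n : ℤ) : CrossL2 1 := eigenLp 1 (.quasiPeriodic 0) n

theorem coeFn_expLp (n : ℤ) : (expLp n : ℝ → ℂ) =ᵐ[crossMeasure 1] expMode n := by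
  have := coeFn_eigenLp 1 (.quasiPeriodic 0) n
  rwa [eigenfun_quasiPeriodic_zero] at this

theorem orthonormal_expLp : Orthonormal ℂ expLp :=
  (orthonormal_eigenLp one_pos (.quasiPeriodic 0)).comp (fun n : ℤ => ⟨n, mem_univ n⟩)
    (fun _ _ h => congrArg Subtype.val h)

/-- The Fourier basis of `L²((0, 1))`. -/
def expBasis : HilbertBasis ℤ ℂ (CrossL2 1) :=
  HilbertBasis.mkOfOrthogonalEqBot orthonormal_expLp <| by
    rw [Submodule.eq_bot_iff]
    intro f hf
    rw [Submodule.mem_orthogonal] at hf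
    have h := ae_eq_zero_of_forall_integral_eigenfun one_pos (.quasiPeriodic 0) (Lp.memLp f)
      fun j => by
        rw [← inner_eigenLp]
        exact hf _ (Submodule.subset_span ⟨j, rfl⟩)
    exact (Lp.eq_zero_iff_ae_eq_zero).2 h

theorem expBasis_apply (n : ℤ) : expBasis n = expLp n := by
  rw [expBasis, HilbertBasis.coe_mkOfOrthogonalEqBot]

/-- Lebesgue measure on `(0, 1) × (0, L)`. -/
abbrev planeMeasure (L : ℝ) : Measure (ℝ × ℝ) := (crossMeasure 1).prod (crossMeasure L)

/-- `L²((0, 1) × (0, L))`. -/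
abbrev PlaneL2 (L : ℝ) : Type := Lp ℂ 2 (planeMeasure L)

theorem planeMeasure_eq (L : ℝ) :
    planeMeasure L = (volume : Measure (ℝ × ℝ)).restrict (Ioo 0 1 ×ˢ Ioo 0 L) := by
  rw [planeMeasure, crossMeasure, crossMeasure, Measure.prod_restrict, ← Measure.volume_eq_prod]

/-- The projection of the plane onto `ℝ/ℤ × ℝ`. -/
def cellProj (x : ℝ × ℝ) : UnitAddCircle × ℝ := ((x.1 : UnitAddCircle), x.2)

/-- Transfers the problem from the circle to the plane, where the test functions of the weak
equation live. -/
theorem measurePreserving_cellProj (L : ℝ) :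
    MeasurePreserving cellProj (planeMeasure L) (cellMeasure L) := by
  have h : MeasurePreserving ((↑) : ℝ → UnitAddCircle) (crossMeasure 1) volume := by
    have := UnitAddCircle.measurePreserving_mk 0
    rw [zero_add] at this
    rwa [crossMeasure, Measure.restrict_congr_set Ioo_ae_eq_Ioc]
  exact h.prod (MeasurePreserving.id (crossMeasure L))

/-- Restriction of a function on the period cell to `(0, 1) × (0, L)`. -/
def toPlane (L : ℝ) : CellL2 L →ₗᵢ[ℂ] PlaneL2 L :=
  Lp.compMeasurePreservingₗᵢ ℂ cellProj (measurePreserving_cellProj L)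

theorem coeFn_toPlane {L : ℝ} (u : CellL2 L) :
    (toPlane L u : ℝ × ℝ → ℂ) =ᵐ[planeMeasure L] periodicLift u :=
  Lp.coeFn_compMeasurePreserving u (measurePreserving_cellProj L)

/-- The Hilbert basis `e^{2πinx₁} ψ_j(x₂)` of `L²((0, 1) × (0, L))`. -/
def planeBasis {L : ℝ} (hL : 0 < L) (γ : LateralBC) :
    HilbertBasis (ℤ × γ.index) ℂ (PlaneL2 L) :=
  tensorBasis expBasis (crossBasis hL γ)

theorem planeBasis_apply {L : ℝ} (hL : 0 < L) (γ : LateralBC) (l : ℤ × γ.index) :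
    planeBasis hL γ l = tensorLp (expLp l.1) (eigenLp L γ l.2) := by
  rw [planeBasis, tensorBasis_apply, expBasis_apply, crossBasis_apply]

theorem coeFn_planeBasis {L : ℝ} (hL : 0 < L) (γ : LateralBC) (l : ℤ × γ.index) :
    (planeBasis hL γ l : ℝ × ℝ → ℂ) =ᵐ[planeMeasure L]
      fun x => expMode l.1 x.1 * γ.eigenfun L l.2 x.2 := by
  rw [planeBasis_apply]
  filter_upwards [coeFn_tensorLp (expLp l.1) (eigenLp L γ l.2),
    ae_prod_fst (ν := crossMeasure L) (coeFn_expLp l.1),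
    ae_prod_snd (μ := crossMeasure 1) (coeFn_eigenLp L γ l.2)] with x h1 h2 h3
  rw [h1, h2, h3]

theorem inner_planeBasis_toPlane {L : ℝ} (hL : 0 < L) (γ : LateralBC) (l : ℤ × γ.index)
    (u : CellL2 L) :
    ⟪planeBasis hL γ l, toPlane L u⟫_ℂ = cellCoeff L γ u (l.1, l.2) := by
  have hm : AEStronglyMeasurable (fun x : UnitAddCircle × ℝ =>
      u x * conj (fourier l.1 x.1 * γ.eigenfun L l.2 x.2)) (cellMeasure L) := by
    refine (Lp.aestronglyMeasurable u).mul (Continuous.aestronglyMeasurable ?_)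
    have := (contDiff_eigenfun L γ l.2).continuous
    fun_prop
  rw [cellCoeff, integral_eq_integral_comp (measurePreserving_cellProj L) hm, L2.inner_def]
  refine integral_congr_ae ?_
  filter_upwards [coeFn_planeBasis hL γ l, coeFn_toPlane u] with x h1 h2
  rw [h1, h2, RCLike.inner_apply, cellProj, periodicLift, fourier_eq_expMode]

/-! ### Multiplication by bounded functions -/

section Mul

variable {α : Type*} [MeasurableSpace α] {μ : Measure α}

/-- Multiplication by an essentially bounded function as an operator on `L²`. -/
def mulOp {h : α → ℂ} (hh : MemLp h ∞ μ) : Lp ℂ 2 μ →L[ℂ] Lp ℂ 2 μ :=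
  (ContinuousLinearMap.mul ℂ ℂ).holderL μ ∞ 2 2 (hh.toLp h)

theorem coeFn_mulOp {h : α → ℂ} (hh : MemLp h ∞ μ) (u : Lp ℂ 2 μ) :
    (mulOp hh u : α → ℂ) =ᵐ[μ] fun x => h x * u x := by
  filter_upwards [(ContinuousLinearMap.mul ℂ ℂ).coeFn_holder (r := 2) (hh.toLp h) u,
    hh.coeFn_toLp] with x h1 h2
  rw [mulOp, ContinuousLinearMap.holderL_apply_apply, h1, h2, ContinuousLinearMap.mul_apply']

theorem inner_mulOp_left {h : α → ℂ} (hh : MemLp h ∞ μ) (hh' : MemLp (fun x => conj (h x)) ∞ μ)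
    (u v : Lp ℂ 2 μ) : ⟪mulOp hh u, v⟫_ℂ = ⟪u, mulOp hh' v⟫_ℂ := by
  simp only [L2.inner_def]
  refine integral_congr_ae ?_
  filter_upwards [coeFn_mulOp hh u, coeFn_mulOp hh' v] with x h1 h2
  rw [h1, h2]
  simp only [RCLike.inner_apply, map_mul]
  ring

theorem mulOp_mulOp_comm {g h : α → ℂ} (hg : MemLp g ∞ μ) (hh : MemLp h ∞ μ) (u : Lp ℂ 2 μ) :
    mulOp hg (mulOp hh u) = mulOp hh (mulOp hg u) := by
  refine Lp.ext ?_
  filter_upwards [coeFn_mulOp hh u, coeFn_mulOp hg u, coeFn_mulOp hg (mulOp hh u),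
    coeFn_mulOp hh (mulOp hg u)] with x h1 h2 h3 h4
  rw [h3, h4, h1, h2, mul_left_comm]

end Mul

/-! ### The permittivity as a bounded, self-adjoint, positive operator. -/

theorem ae_planeMeasure_of_ae_strip {L : ℝ} {p : ℝ × ℝ → Prop}
    (h : ∀ᵐ x ∂((volume : Measure (ℝ × ℝ)).restrict (strip L)), p x) :
    ∀ᵐ x ∂(planeMeasure L), p x := by
  rw [planeMeasure_eq]
  exact ae_restrict_of_ae_restrict_of_subset (prod_mono (subset_univ _) subset_rfl) h

theorem IsPermittivity.memLp {L : ℝ} {ε : ℝ × ℝ → ℝ} (hε : IsPermittivity L ε) :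
    MemLp (fun x => (ε x : ℂ)) ∞ (planeMeasure L) := by
  obtain ⟨c, hc, hlow⟩ := hε.lower
  obtain ⟨C, hup⟩ := hε.upper
  refine memLp_top_of_bound ?_ C ?_
  · have : AEMeasurable ε (planeMeasure L) := by
      rw [planeMeasure_eq]
      exact hε.aemeasurable.mono_measure
        (Measure.restrict_mono (prod_mono (subset_univ _) subset_rfl) le_rfl)
    exact (Complex.measurable_ofReal.comp_aemeasurable this).aestronglyMeasurable
  · filter_upwards [ae_planeMeasure_of_ae_strip hlow, ae_planeMeasure_of_ae_strip hup] with x h1 h2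
    rw [Complex.norm_real, Real.norm_of_nonneg (hc.le.trans h1)]
    exact h2

/-- Multiplication by the permittivity. -/
def permOp {L : ℝ} {ε : ℝ × ℝ → ℝ} (hε : IsPermittivity L ε) : PlaneL2 L →L[ℂ] PlaneL2 L :=
  mulOp hε.memLp

theorem inner_permOp_left {L : ℝ} {ε : ℝ × ℝ → ℝ} (hε : IsPermittivity L ε) (u v : PlaneL2 L) :
    ⟪permOp hε u, v⟫_ℂ = ⟪u, permOp hε v⟫_ℂ := by
  have : MemLp (fun x => conj (ε x : ℂ)) ∞ (planeMeasure L) := by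
    simp only [Complex.conj_ofReal]; exact hε.memLp
  rw [permOp, inner_mulOp_left _ this]
  congr 2
  simp only [Complex.conj_ofReal]

theorem re_inner_permOp_self_pos {L : ℝ} {ε : ℝ × ℝ → ℝ} (hε : IsPermittivity L ε)
    {u : PlaneL2 L} (hu : u ≠ 0) : 0 < (⟪u, permOp hε u⟫_ℂ).re := by
  obtain ⟨c, hc, hlow⟩ := hε.lower
  have h1 : c * ‖u‖ ^ 2 ≤ (⟪u, permOp hε u⟫_ℂ).re := by
    have h2 : (⟪u, permOp hε u⟫_ℂ).re = ∫ x, (⟪u x, permOp hε u x⟫_ℂ).re ∂(planeMeasure L) := by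
      rw [L2.inner_def]
      exact (integral_re (L2.integrable_inner (𝕜 := ℂ) u (permOp hε u))).symm
    have h3 : ‖u‖ ^ 2 = ∫ x, (⟪u x, u x⟫_ℂ).re ∂(planeMeasure L) := by
      have : ‖u‖ ^ 2 = (⟪u, u⟫_ℂ).re := (inner_self_eq_norm_sq (𝕜 := ℂ) u).symm
      rw [this, L2.inner_def]
      exact (integral_re (L2.integrable_inner (𝕜 := ℂ) u u)).symm
    rw [h2, h3, ← integral_const_mul]
    refine integral_mono_ae ((L2.integrable_inner (𝕜 := ℂ) u u).re.const_mul c)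
      (L2.integrable_inner (𝕜 := ℂ) u (permOp hε u)).re ?_
    filter_upwards [ae_planeMeasure_of_ae_strip hlow, coeFn_mulOp hε.memLp u] with x hx1 hx2
    have h4 : permOp hε u x = ε x * u x := hx2
    have h5 : (u x * conj (u x)).re = ‖u x‖ ^ 2 := by
      rw [Complex.mul_conj, Complex.ofReal_re, Complex.normSq_eq_norm_sq]
    simp only [h4, RCLike.inner_apply]
    rw [mul_assoc, Complex.re_ofReal_mul, h5]
    gcongr
  have : 0 < ‖u‖ := norm_pos_iff.2 hu
  exact lt_of_lt_of_le (by positivity) h1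

/-! ### Derivatives of the modes -/

theorem hasDerivAt_partial₁ {φ : ℝ × ℝ → ℂ} {x : ℝ × ℝ} (h : DifferentiableAt ℝ φ x) :
    HasDerivAt (fun t => φ (t, x.2)) (partial₁ φ x) x.1 := by
  have h1 : HasDerivAt (fun t : ℝ => (t, x.2)) ((1 : ℝ), (0 : ℝ)) x.1 :=
    (hasDerivAt_id x.1).prodMk (hasDerivAt_const x.1 x.2)
  exact h.hasFDerivAt.comp_hasDerivAt x.1 h1

theorem hasDerivAt_partial₂ {φ : ℝ × ℝ → ℂ} {x : ℝ × ℝ} (h : DifferentiableAt ℝ φ x) :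
    HasDerivAt (fun t => φ (x.1, t)) (partial₂ φ x) x.2 := by
  have h1 : HasDerivAt (fun t : ℝ => (x.1, t)) ((0 : ℝ), (1 : ℝ)) x.2 :=
    (hasDerivAt_const x.2 x.1).prodMk (hasDerivAt_id x.2)
  exact h.hasFDerivAt.comp_hasDerivAt x.2 h1

theorem hasDerivAt_expMode (n : ℤ) (t : ℝ) :
    HasDerivAt (expMode n) (2 * Real.pi * Complex.I * n * expMode n t) t := by
  have h := ((hasDerivAt_id' t).ofReal_comp.const_mul (2 * Real.pi * Complex.I * n)).cexp
  refine HasDerivAt.congr_deriv h ?_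
  rw [expMode]; push_cast; ring

theorem deriv_deriv_eigenfun (L : ℝ) (γ : LateralBC) (k : ℤ) (t : ℝ) :
    deriv (deriv (γ.eigenfun L k)) t = -(γ.freq L k : ℂ) ^ 2 * γ.eigenfun L k t := by
  have hsin : ∀ a κ t : ℝ, HasDerivAt (fun t : ℝ => ((a * Real.sin (κ * t) : ℝ) : ℂ))
      ((a * κ * Real.cos (κ * t) : ℝ) : ℂ) t := fun a κ t => by
    refine HasDerivAt.congr_deriv (((hasDerivAt_id' t).const_mul κ).sin.const_mul a).ofReal_comp ?_
    push_cast; ring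
  have hcos : ∀ a κ t : ℝ, HasDerivAt (fun t : ℝ => ((a * Real.cos (κ * t) : ℝ) : ℂ))
      ((-a * κ * Real.sin (κ * t) : ℝ) : ℂ) t := fun a κ t => by
    refine HasDerivAt.congr_deriv (((hasDerivAt_id' t).const_mul κ).cos.const_mul a).ofReal_comp ?_
    push_cast; ring
  have hs : ∀ a κ t : ℝ, deriv (deriv fun t : ℝ => ((a * Real.sin (κ * t) : ℝ) : ℂ)) t
      = -(κ : ℂ) ^ 2 * ((a * Real.sin (κ * t) : ℝ) : ℂ) := fun a κ t => by
    rw [funext fun t => (hsin a κ t).deriv, (hcos (a * κ) κ t).deriv]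
    push_cast; ring
  have hc : ∀ a κ t : ℝ, deriv (deriv fun t : ℝ => ((a * Real.cos (κ * t) : ℝ) : ℂ)) t
      = -(κ : ℂ) ^ 2 * ((a * Real.cos (κ * t) : ℝ) : ℂ) := fun a κ t => by
    rw [funext fun t => (hcos a κ t).deriv, (hsin (-a * κ) κ t).deriv]
    push_cast; ring
  cases γ with
  | dirichlet => exact hs _ _ t
  | neumann => exact hc _ _ t
  | mixed => exact hs _ _ t
  | quasiPeriodic β =>
    have he : ∀ (a κ : ℂ) (t : ℝ), HasDerivAt (fun t : ℝ => a * Complex.exp (Complex.I * κ * t))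
        (a * (Complex.I * κ) * Complex.exp (Complex.I * κ * t)) t := fun a κ t => by
      refine HasDerivAt.congr_deriv
        (((hasDerivAt_id' t).ofReal_comp.const_mul (Complex.I * κ)).cexp.const_mul a) ?_
      push_cast; ring
    have := fun a κ => funext fun t => (he a κ t).deriv
    change deriv (deriv fun t : ℝ => _) t = _
    simp only [LateralBC.eigenfun]
    rw [this, (he _ _ t).deriv]
    linear_combination ((√(1 / L) : ℂ) * (((LateralBC.quasiPeriodic β).freq L k : ℂ)) ^ 2
      * Complex.exp (Complex.I * ((LateralBC.quasiPeriodic β).freq L k : ℂ) * t)) * Complex.I_mul_I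

/-- The smooth function `e^{2πinx₁} ψ_k(x₂)`. -/
def modeFun (L : ℝ) (γ : LateralBC) (l : ℤ × ℤ) (x : ℝ × ℝ) : ℂ :=
  expMode l.1 x.1 * γ.eigenfun L l.2 x.2

theorem contDiff_modeFun (L : ℝ) (γ : LateralBC) (l : ℤ × ℤ) : ContDiff ℝ ∞ (modeFun L γ l) :=
  ((contDiff_expMode l.1).comp contDiff_fst).mul ((contDiff_eigenfun L γ l.2).comp contDiff_snd)

theorem differentiable_of_contDiff {φ : ℝ × ℝ → ℂ} (h : ContDiff ℝ ∞ φ) : Differentiable ℝ φ :=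
  h.differentiable (by simp)

theorem partial₁_modeFun (L : ℝ) (γ : LateralBC) (l : ℤ × ℤ) (x : ℝ × ℝ) :
    partial₁ (modeFun L γ l) x = 2 * Real.pi * Complex.I * l.1 * modeFun L γ l x := by
  refine (hasDerivAt_partial₁ (differentiable_of_contDiff (contDiff_modeFun L γ l) x)).unique ?_
  have := (hasDerivAt_expMode l.1 x.1).mul_const (γ.eigenfun L l.2 x.2)
  rwa [mul_assoc] at this

theorem partial₂_modeFun (L : ℝ) (γ : LateralBC) (l : ℤ × ℤ) (x : ℝ × ℝ) :
    partial₂ (modeFun L γ l) x = expMode l.1 x.1 * deriv (γ.eigenfun L l.2) x.2 := by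
  refine (hasDerivAt_partial₂ (differentiable_of_contDiff (contDiff_modeFun L γ l) x)).unique ?_
  exact ((contDiff_eigenfun L γ l.2).differentiable (by simp) x.2).hasDerivAt.const_mul (expMode l.1 x.1)

theorem contDiff_partial₁ {φ : ℝ × ℝ → ℂ} (h : ContDiff ℝ ∞ φ) : ContDiff ℝ ∞ (partial₁ φ) :=
  (h.fderiv_right (m := ∞) (by simp)).clm_apply contDiff_const

theorem contDiff_partial₂ {φ : ℝ × ℝ → ℂ} (h : ContDiff ℝ ∞ φ) : ContDiff ℝ ∞ (partial₂ φ) :=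
  (h.fderiv_right (m := ∞) (by simp)).clm_apply contDiff_const

theorem partial₂_partial₂_modeFun (L : ℝ) (γ : LateralBC) (l : ℤ × ℤ) (x : ℝ × ℝ) :
    partial₂ (partial₂ (modeFun L γ l)) x = -(γ.freq L l.2 : ℂ) ^ 2 * modeFun L γ l x := by
  refine (hasDerivAt_partial₂ (differentiable_of_contDiff
    (contDiff_partial₂ (contDiff_modeFun L γ l)) x)).unique ?_
  simp only [partial₂_modeFun]
  have h : ContDiff ℝ ∞ (deriv (γ.eigenfun L l.2)) :=
    (contDiff_infty_iff_deriv.1 (contDiff_eigenfun L γ l.2)).2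
  have := (h.differentiable (by simp) x.2).hasDerivAt.const_mul (expMode l.1 x.1)
  rw [deriv_deriv_eigenfun] at this
  refine this.congr_deriv ?_
  rw [modeFun]; ring

theorem hasCompactSupport_partial₁ {φ : ℝ × ℝ → ℂ} (h : HasCompactSupport φ) :
    HasCompactSupport (partial₁ φ) := h.fderiv_apply ℝ _

theorem hasCompactSupport_partial₂ {φ : ℝ × ℝ → ℂ} (h : HasCompactSupport φ) :
    HasCompactSupport (partial₂ φ) := h.fderiv_apply ℝ _

/-! ### Integration by parts against a mode. -/

theorem integral_mul_fderiv_of_hasCompactSupport {f g : ℝ × ℝ → ℂ} (hf : ContDiff ℝ ∞ f)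
    (hg : ContDiff ℝ ∞ g) (hc : HasCompactSupport g) (v : ℝ × ℝ) :
    ∫ x, f x * fderiv ℝ g x v = -∫ x, fderiv ℝ f x v * g x := by
  have hf' : Continuous fun x => fderiv ℝ f x v :=
    ((hf.fderiv_right (m := ∞) (by simp)).clm_apply contDiff_const).continuous
  have hg' : Continuous fun x => fderiv ℝ g x v :=
    ((hg.fderiv_right (m := ∞) (by simp)).clm_apply contDiff_const).continuous
  refine integral_mul_fderiv_eq_neg_fderiv_mul_of_integrable ?_ ?_ ?_
    (fun x _ => differentiable_of_contDiff hf x) (fun x _ => differentiable_of_contDiff hg x)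
  · exact (hf'.mul hg.continuous).integrable_of_hasCompactSupport hc.mul_left
  · exact (hf.continuous.mul hg').integrable_of_hasCompactSupport (hc.fderiv_apply ℝ v).mul_left
  · exact (hf.continuous.mul hg.continuous).integrable_of_hasCompactSupport hc.mul_left

/-- The symbol `(2πn + ξ)² + κ²` of `-Δ_ξ`. -/
def symbol (L : ℝ) (γ : LateralBC) (ξ : ℂ) (l : ℤ × ℤ) : ℂ :=
  (2 * Real.pi * l.1 + ξ) ^ 2 + (γ.freq L l.2 : ℂ) ^ 2

/-- The transpose of `Δ_{-ξ}` is `Δ_ξ`, and the mode is an eigenfunction of it; compact support of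
`φ` removes boundary terms. -/
theorem integral_modeFun_mul_twistedLaplacian (L : ℝ) (γ : LateralBC) (ξ : ℂ) (l : ℤ × ℤ)
    {φ : ℝ × ℝ → ℂ} (hφ : ContDiff ℝ ∞ φ) (hc : HasCompactSupport φ) :
    ∫ x, modeFun L γ l x * twistedLaplacian (-ξ) φ x
      = -symbol L γ ξ l * ∫ x, modeFun L γ l x * φ x := by
  have hm := contDiff_modeFun L γ l
  set E := modeFun L γ l with hE
  have h1 : ∀ {ψ : ℝ × ℝ → ℂ}, ContDiff ℝ ∞ ψ → HasCompactSupport ψ →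
      ∫ x, E x * partial₁ ψ x = -(2 * Real.pi * Complex.I * l.1) * ∫ x, E x * ψ x := by
    intro ψ hψ hψc
    have h2 := integral_mul_fderiv_of_hasCompactSupport hm hψ hψc (1, 0)
    change ∫ x, E x * partial₁ ψ x = -∫ x, partial₁ E x * ψ x at h2
    rw [h2, ← integral_neg, ← integral_const_mul]
    congr 1; ext x
    rw [hE, partial₁_modeFun]; ring
  have h2 : ∫ x, E x * partial₂ (partial₂ φ) x = -(γ.freq L l.2 : ℂ) ^ 2 * ∫ x, E x * φ x := by
    have h3 := integral_mul_fderiv_of_hasCompactSupport hm (contDiff_partial₂ hφ)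
      (hasCompactSupport_partial₂ hc) (0, 1)
    have h4 := integral_mul_fderiv_of_hasCompactSupport (contDiff_partial₂ hm) hφ hc (0, 1)
    change ∫ x, E x * partial₂ (partial₂ φ) x = -∫ x, partial₂ E x * partial₂ φ x at h3
    change ∫ x, partial₂ E x * partial₂ φ x = -∫ x, partial₂ (partial₂ E) x * φ x at h4
    rw [h3, h4, neg_neg, ← integral_const_mul]
    congr 1; ext x
    rw [hE, partial₂_partial₂_modeFun]; ring
  have hi : ∀ {ψ : ℝ × ℝ → ℂ}, ContDiff ℝ ∞ ψ → HasCompactSupport ψ →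
      Integrable (fun x => E x * ψ x) := fun hψ hψc =>
    (hm.continuous.mul hψ.continuous).integrable_of_hasCompactSupport hψc.mul_left
  have hp1 := contDiff_partial₁ hφ
  have hp1c := hasCompactSupport_partial₁ hc
  have i1 := hi (contDiff_partial₁ hp1) (hasCompactSupport_partial₁ hp1c)
  have i2 := hi (contDiff_partial₂ (contDiff_partial₂ hφ))
    (hasCompactSupport_partial₂ (hasCompactSupport_partial₂ hc))
  have i3 := (hi hp1 hp1c).const_mul (2 * Complex.I * -ξ)
  have i4 := (hi hφ hc).const_mul ((-ξ) ^ 2)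
  have h5 : ∀ x, E x * twistedLaplacian (-ξ) φ x
      = E x * partial₁ (partial₁ φ) x + E x * partial₂ (partial₂ φ) x
        + 2 * Complex.I * -ξ * (E x * partial₁ φ x) - (-ξ) ^ 2 * (E x * φ x) := by
    intro x; rw [twistedLaplacian]; ring
  simp_rw [h5]
  have e1 := integral_sub ((i1.add i2).add i3) i4
  have e2 := integral_add (i1.add i2) i3
  have e3 := integral_add i1 i2
  simp only [Pi.add_apply] at e1 e2 e3
  rw [e1, e2, e3, integral_const_mul, integral_const_mul, h1 hp1 hp1c, h1 hφ hc, h2, symbol]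
  linear_combination (4 * Real.pi ^ 2 * l.1 ^ 2 + 4 * Real.pi * l.1 * ξ) *
    (∫ x, E x * φ x) * Complex.I_mul_I

/-! ### The cell equation in terms of Fourier coefficients -/

/-- The constant comes from `(a + b)² ≤ 2a² + 2b²`. The bound makes the coefficients of `Δ_ξ u`
square summable for `u` in `H2`. -/
theorem norm_symbol_le (L : ℝ) (γ : LateralBC) (ξ : ℂ) (l : ℤ × ℤ) :
    ‖symbol L γ ξ l‖ ≤ (2 + 2 * ‖ξ‖ ^ 2) * (1 + (2 * Real.pi * l.1) ^ 2 + γ.freq L l.2 ^ 2) := by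
  have h1 : ‖symbol L γ ξ l‖ ≤ (|2 * Real.pi * l.1| + ‖ξ‖) ^ 2 + γ.freq L l.2 ^ 2 := by
    rw [symbol]
    refine (norm_add_le _ _).trans ?_
    rw [norm_pow, norm_pow, Complex.norm_real, Real.norm_eq_abs, sq_abs]
    gcongr
    refine (norm_add_le _ _).trans (le_of_eq ?_)
    congr 1
    rw [← Real.norm_eq_abs, ← Complex.norm_real]
    push_cast; rfl
  have h2 := sq_abs (2 * Real.pi * l.1)
  nlinarith [sq_nonneg (|2 * Real.pi * l.1| - ‖ξ‖), sq_nonneg (γ.freq L l.2),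
    mul_nonneg (sq_nonneg ‖ξ‖) (sq_nonneg (γ.freq L l.2)),
    mul_nonneg (sq_nonneg ‖ξ‖) (sq_nonneg (2 * Real.pi * l.1))]

theorem summable_norm_symbol_mul_sq {L : ℝ} {γ : LateralBC} {u : CellL2 L} (hu : u ∈ H2 L γ)
    (ξ : ℂ) : Summable fun l : ℤ × γ.index =>
      ‖symbol L γ ξ (l.1, l.2) * cellCoeff L γ u (l.1, l.2)‖ ^ 2 := by
  refine Summable.of_nonneg_of_le (fun _ => by positivity) (fun l => ?_)
    (Summable.mul_left ((2 + 2 * ‖ξ‖ ^ 2) ^ 2) hu)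
  have h := pow_le_pow_left₀ (norm_nonneg _) (norm_symbol_le L γ ξ (l.1, l.2)) 2
  have h' := mul_le_mul_of_nonneg_right h (sq_nonneg ‖cellCoeff L γ u (l.1, l.2)‖)
  rwa [mul_pow, mul_assoc, ← mul_pow, ← norm_mul] at h'

theorem exists_planeL2_of_summable {L : ℝ} (hL : 0 < L) (γ : LateralBC) {c : ℤ × γ.index → ℂ}
    (hc : Summable fun l => ‖c l‖ ^ 2) : ∃ f : PlaneL2 L, ∀ l, ⟪planeBasis hL γ l, f⟫_ℂ = c l := by
  have hc' : Memℓp c 2 := by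
    rw [memℓp_gen_iff (by simp)]
    simpa using hc
  refine ⟨(planeBasis hL γ).repr.symm ⟨c, hc'⟩, fun l => ?_⟩
  rw [← HilbertBasis.repr_apply_apply, LinearIsometryEquiv.apply_symm_apply]

theorem continuous_twistedLaplacian (ξ : ℂ) {φ : ℝ × ℝ → ℂ} (hφ : ContDiff ℝ ∞ φ) :
    Continuous (twistedLaplacian ξ φ) := by
  have h1 := (contDiff_partial₁ hφ).continuous
  have h2 := (contDiff_partial₁ (contDiff_partial₁ hφ)).continuous
  have h3 := (contDiff_partial₂ (contDiff_partial₂ hφ)).continuous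
  have h4 := hφ.continuous
  unfold twistedLaplacian
  fun_prop

theorem twistedLaplacian_eq_zero_of_notMem (ξ : ℂ) {φ : ℝ × ℝ → ℂ} {x : ℝ × ℝ}
    (hx : x ∉ tsupport φ) : twistedLaplacian ξ φ x = 0 := by
  have h1 : ∀ {ψ : ℝ × ℝ → ℂ}, x ∉ tsupport ψ → ∀ v, x ∉ tsupport fun x => fderiv ℝ ψ x v :=
    fun hψ v h => hψ (tsupport_fderiv_apply_subset ℝ v h)
  have e0 := image_eq_zero_of_notMem_tsupport hx
  have e1 := image_eq_zero_of_notMem_tsupport (h1 hx (1, 0))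
  have e2 := image_eq_zero_of_notMem_tsupport (h1 (h1 hx (1, 0)) (1, 0))
  have e3 := image_eq_zero_of_notMem_tsupport (h1 (h1 hx (0, 1)) (0, 1))
  have e1' : partial₁ φ x = 0 := e1
  have e2' : partial₁ (partial₁ φ) x = 0 := e2
  have e3' : partial₂ (partial₂ φ) x = 0 := e3
  rw [twistedLaplacian, e0, e1', e2', e3']
  ring

theorem integral_planeMeasure_of_forall_notMem {L : ℝ} {f : ℝ × ℝ → ℂ}
    (h : ∀ x ∉ Ioo (0 : ℝ) 1 ×ˢ Ioo 0 L, f x = 0) : ∫ x, f x ∂(planeMeasure L) = ∫ x, f x := by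
  rw [planeMeasure_eq]
  exact setIntegral_eq_integral_of_forall_compl_eq_zero h

theorem memLp_conj_of_continuous {L : ℝ} {f : ℝ × ℝ → ℂ} (hf : Continuous f)
    (hs : HasCompactSupport f) :
    MemLp (fun x => conj (f x)) 2 (planeMeasure L) := by
  rw [planeMeasure_eq]
  refine ((Complex.continuous_conj.comp hf).memLp_of_hasCompactSupport ?_).restrict _
  exact hs.comp_left (map_zero _)

theorem inner_toLp_conj {L : ℝ} {k : ℝ × ℝ → ℂ}
    (hk : MemLp (fun x => conj (k x)) 2 (planeMeasure L)) (u : PlaneL2 L) :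
    ⟪hk.toLp _, u⟫_ℂ = ∫ x, u x * k x ∂(planeMeasure L) := by
  rw [L2.inner_def]
  refine integral_congr_ae ?_
  filter_upwards [hk.coeFn_toLp] with x hx
  rw [hx, RCLike.inner_apply, Complex.conj_conj]

theorem SolvesCellEquation.integral_eq_zero {L : ℝ} {ε : ℝ × ℝ → ℝ} {ξ μ : ℂ} {u : CellL2 L}
    (h : SolvesCellEquation ε ξ μ u) {φ : ℝ × ℝ → ℂ} (hφ : ContDiff ℝ ∞ φ)
    (hc : HasCompactSupport φ) (hs : tsupport φ ⊆ Ioo 0 1 ×ˢ Ioo 0 L) :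
    ∫ x, (toPlane L u x * twistedLaplacian (-ξ) φ x
      + μ * (ε x : ℂ) * toPlane L u x * φ x) ∂(planeMeasure L) = 0 := by
  have hsub : Ioo (0 : ℝ) 1 ×ˢ Ioo 0 L ⊆ strip L := prod_mono (subset_univ _) subset_rfl
  rw [← h φ hφ hc (hs.trans hsub), setIntegral_eq_of_subset_of_forall_sdiff_eq_zero
    (show MeasurableSet (strip L) from MeasurableSet.univ.prod measurableSet_Ioo) hsub, ← planeMeasure_eq]
  · refine integral_congr_ae ?_
    filter_upwards [coeFn_toPlane u] with x hx
    rw [hx]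
  · intro x hx
    have h1 : x ∉ tsupport φ := fun h' => hx.2 (hs h')
    rw [twistedLaplacian_eq_zero_of_notMem _ h1, image_eq_zero_of_notMem_tsupport h1]
    ring

/-- Let `f` be the `L²` function whose coefficients are symbol times those of `u`; it represents
`-Δ_ξ u`. Testing on the open rectangle shows `f = μεu` almost everywhere. Such test functions do
not see the boundary; periodicity and the lateral condition enter through membership in `H2`, which
is what makes `f` exist. -/
theorem symbol_mul_cellCoeff {L : ℝ} (hL : 0 < L) {γ : LateralBC} {ε : ℝ × ℝ → ℝ}
    (hε : IsPermittivity L ε) {ξ μ : ℂ} {u : CellL2 L} (hu : u ∈ H2 L γ)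
    (h : SolvesCellEquation ε ξ μ u) (l : ℤ × γ.index) :
    symbol L γ ξ (l.1, l.2) * ⟪planeBasis hL γ l, toPlane L u⟫_ℂ
      = μ * ⟪planeBasis hL γ l, permOp hε (toPlane L u)⟫_ℂ := by
  obtain ⟨f, hf⟩ := exists_planeL2_of_summable hL γ (summable_norm_symbol_mul_sq hu ξ)
  set v := toPlane L u with hv
  suffices hfv : f = μ • permOp hε v by
    rw [inner_planeBasis_toPlane, ← hf, hfv, inner_smul_right]
  have key : ∀ φ : ℝ × ℝ → ℂ, ContDiff ℝ ∞ φ → HasCompactSupport φ →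
      tsupport φ ⊆ Ioo 0 1 ×ˢ Ioo 0 L →
      ∫ x, (μ • permOp hε v - f) x * φ x ∂(planeMeasure L) = 0 := by
    intro φ hφ hc hs
    have hΔc := continuous_twistedLaplacian (-ξ) hφ
    have hΔs : HasCompactSupport (twistedLaplacian (-ξ) φ) :=
      hc.mono' fun x hx => by
        by_contra h'
        exact hx (twistedLaplacian_eq_zero_of_notMem _ h')
    have hk0 := memLp_conj_of_continuous (L := L) hφ.continuous hc
    have hk1 := memLp_conj_of_continuous (L := L) hΔc hΔs
    have h1 : ∀ m, ⟪hk1.toLp _, planeBasis hL γ m⟫_ℂ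
        = -symbol L γ ξ (m.1, m.2) * ⟪hk0.toLp _, planeBasis hL γ m⟫_ℂ := by
      intro m
      have h2 : ∀ k : ℝ × ℝ → ℂ, (∀ x ∉ tsupport φ, k x = 0) →
          ∫ x, planeBasis hL γ m x * k x ∂(planeMeasure L)
            = ∫ x, modeFun L γ (m.1, m.2) x * k x := by
        intro k hk
        rw [← integral_planeMeasure_of_forall_notMem (L := L)]
        · refine integral_congr_ae ?_
          filter_upwards [coeFn_planeBasis hL γ m] with x hx
          rw [hx, modeFun]
        · intro x hx
          rw [hk x fun h' => hx (hs h'), mul_zero]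
      rw [inner_toLp_conj, inner_toLp_conj,
        h2 _ fun x hx => twistedLaplacian_eq_zero_of_notMem _ hx,
        h2 _ fun x hx => image_eq_zero_of_notMem_tsupport hx]
      exact integral_modeFun_mul_twistedLaplacian L γ ξ _ hφ hc
    -- Parseval assembles the modewise identities `h1` into the weak form of `-Δ_ξ v = f`.
    have h2 : ⟪hk1.toLp _, v⟫_ℂ = -⟪hk0.toLp _, f⟫_ℂ := by
      rw [← HilbertBasis.tsum_inner_mul_inner (planeBasis hL γ),
        ← HilbertBasis.tsum_inner_mul_inner (planeBasis hL γ) _ f, ← tsum_neg]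
      congr 1; ext m
      rw [h1, hf, hv, inner_planeBasis_toPlane]
      ring
    have h3 := h.integral_eq_zero hφ hc hs
    have i1 : Integrable (fun x => v x * twistedLaplacian (-ξ) φ x) (planeMeasure L) := by
      have := L2.integrable_inner (𝕜 := ℂ) (hk1.toLp _) v
      refine this.congr ?_
      filter_upwards [hk1.coeFn_toLp] with x hx
      rw [hx, RCLike.inner_apply, Complex.conj_conj]
    have i2 : Integrable (fun x => (μ • permOp hε v) x * φ x) (planeMeasure L) := by
      have := L2.integrable_inner (𝕜 := ℂ) (hk0.toLp _) (μ • permOp hε v)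
      refine this.congr ?_
      filter_upwards [hk0.coeFn_toLp] with x hx
      rw [hx, RCLike.inner_apply, Complex.conj_conj]
    have e2 : ∀ᵐ x ∂(planeMeasure L), μ * (ε x : ℂ) * v x * φ x
        = (μ • permOp hε v) x * φ x := by
      filter_upwards [Lp.coeFn_smul μ (permOp hε v), coeFn_mulOp hε.memLp v] with x hx1 hx2
      have h4 : permOp hε v x = ε x * v x := hx2
      rw [hx1, Pi.smul_apply, h4, smul_eq_mul]
      ring
    rw [integral_add i1 (i2.congr (e2.mono fun x hx => hx.symm)), integral_congr_ae e2,
      ← inner_toLp_conj hk1, ← inner_toLp_conj hk0, h2] at h3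
    rw [← inner_toLp_conj hk0, inner_sub_right]
    linear_combination h3
  have hint : IntegrableOn (μ • permOp hε v - f : PlaneL2 L) (Ioo (0 : ℝ) 1 ×ˢ Ioo 0 L) := by
    rw [IntegrableOn, ← planeMeasure_eq]
    exact (Lp.memLp _).integrable (by norm_num)
  -- Fundamental lemma of the calculus of variations; real test functions suffice.
  have hz := IsOpen.ae_eq_zero_of_integral_contDiff_smul_eq_zero (μ := volume)
    (isOpen_Ioo.prod isOpen_Ioo) hint.locallyIntegrableOn fun g hg hgc hgs => by
      have hgs' : tsupport (fun x => (g x : ℂ)) ⊆ Ioo 0 1 ×ˢ Ioo 0 L :=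
        (closure_mono (Function.support_comp_subset Complex.ofReal_zero g)).trans hgs
      have h1 := key (fun x => (g x : ℂ)) (Complex.ofRealCLM.contDiff.comp hg)
        (hgc.comp_left Complex.ofReal_zero) hgs'
      rw [integral_planeMeasure_of_forall_notMem] at h1
      · rw [← h1]
        congr 1; ext x
        rw [Complex.real_smul, mul_comm]
      · intro x hx
        have : (g x : ℂ) = 0 :=
          image_eq_zero_of_notMem_tsupport (f := fun x => (g x : ℂ)) fun h' => hx (hgs' h')
        rw [this, mul_zero]
  have hz' : (μ • permOp hε v - f : PlaneL2 L) = 0 := by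
    rw [Lp.eq_zero_iff_ae_eq_zero]
    refine (show ∀ᵐ x ∂(planeMeasure L), (μ • permOp hε v - f : PlaneL2 L) x = 0 from ?_)
    have := (ae_restrict_iff' (μ := (volume : Measure (ℝ × ℝ)))
      (measurableSet_Ioo.prod measurableSet_Ioo)).2 hz
    rwa [← planeMeasure_eq] at this
  exact (sub_eq_zero.1 hz').symm

/-! ### The group velocity and the flux in terms of Fourier coefficients -/

/-- The coefficient form of `Δ_ξ v + μ ε v = 0`. -/
def IsCoeffSolution {L : ℝ} (hL : 0 < L) (γ : LateralBC) {ε : ℝ × ℝ → ℝ}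
    (hε : IsPermittivity L ε) (ξ μ : ℂ) (v : PlaneL2 L) : Prop :=
  ∀ l : ℤ × γ.index, symbol L γ ξ (l.1, l.2) * ⟪planeBasis hL γ l, v⟫_ℂ
    = μ * ⟪planeBasis hL γ l, permOp hε v⟫_ℂ

theorem conj_symbol (L : ℝ) (γ : LateralBC) (ξ : ℝ) (l : ℤ × ℤ) :
    conj (symbol L γ ξ l) = symbol L γ ξ l := by
  simp only [symbol, map_add, map_pow, map_mul, Complex.conj_ofReal, map_intCast, map_ofNat]

theorem IsCoeffSolution.conj {L : ℝ} {hL : 0 < L} {γ : LateralBC} {ε : ℝ × ℝ → ℝ}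
    {hε : IsPermittivity L ε} {ξ μ : ℝ} {v : PlaneL2 L} (h : IsCoeffSolution hL γ hε ξ μ v)
    (l : ℤ × γ.index) : symbol L γ ξ (l.1, l.2) * ⟪v, planeBasis hL γ l⟫_ℂ
      = μ * ⟪permOp hε v, planeBasis hL γ l⟫_ℂ := by
  have := congrArg (starRingEnd ℂ) (h l)
  rwa [map_mul, map_mul, conj_symbol, inner_conj_symm, inner_conj_symm, Complex.conj_ofReal] at this

theorem hasDerivAt_symbol (L : ℝ) (γ : LateralBC) (ξ : ℂ) (l : ℤ × ℤ) :
    HasDerivAt (fun z => symbol L γ z l) (2 * (2 * Real.pi * l.1 + ξ)) ξ := by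
  have h := (((hasDerivAt_id' ξ).const_add (2 * Real.pi * l.1 : ℂ)).pow 2).add_const
    ((γ.freq L l.2 : ℂ) ^ 2)
  refine h.congr_deriv ?_
  push_cast; ring

/-- Hellmann–Feynman: differentiate the coefficient equation and pair it with `v`; the terms with
`V'` cancel since `v` solves the same equation and the operators are symmetric at real `ξ`. Keeping
`v` independent of `V ξ` is what later yields orthogonality of different bands. -/
theorem hasSum_slope {L : ℝ} {hL : 0 < L} {γ : LateralBC} {ε : ℝ × ℝ → ℝ}
    {hε : IsPermittivity L ε} {ξ μ : ℝ} {lam : ℂ → ℂ} {lam' : ℂ} {V : ℂ → PlaneL2 L}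
    {V' v : PlaneL2 L} (hlam : HasDerivAt lam lam' ξ) (hV : HasDerivAt V V' ξ)
    (hsol : ∀ᶠ z in 𝓝 (ξ : ℂ), IsCoeffSolution hL γ hε z (lam z) (V z)) (hμ : lam ξ = μ)
    (hv : IsCoeffSolution hL γ hε ξ μ v) :
    HasSum (fun l : ℤ × γ.index => 2 * (2 * Real.pi * l.1 + ξ) *
        (⟪planeBasis hL γ l, V ξ⟫_ℂ * ⟪v, planeBasis hL γ l⟫_ℂ))
      (lam' * ⟪v, permOp hε (V ξ)⟫_ℂ) := by
  set b := planeBasis hL γ with hb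
  have hinner : ∀ l (A : PlaneL2 L →L[ℂ] PlaneL2 L),
      HasDerivAt (fun z => ⟪b l, A (V z)⟫_ℂ) ⟪b l, A V'⟫_ℂ ξ := fun l A =>
    ((innerSL ℂ (b l)).comp A).hasFDerivAt.comp_hasDerivAt (ξ : ℂ) hV
  have hd : ∀ l : ℤ × γ.index, 2 * (2 * Real.pi * l.1 + ξ) * ⟪b l, V ξ⟫_ℂ
      + symbol L γ ξ (l.1, l.2) * ⟪b l, V'⟫_ℂ
      = lam' * ⟪b l, permOp hε (V ξ)⟫_ℂ + μ * ⟪b l, permOp hε V'⟫_ℂ := by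
    intro l
    have h1 := (hasDerivAt_symbol L γ ξ (l.1, l.2)).mul (hinner l (.id ℂ _))
    have h2 := hlam.mul (hinner l (permOp hε))
    rw [hμ] at h2
    refine h1.unique (h2.congr_of_eventuallyEq ?_)
    filter_upwards [hsol] with z hz
    exact hz l
  -- The symbol is moved from `V'` to `v` and replaced there by `μ ε`. All three series are then
  -- Parseval sums, and no `H²` regularity of `V'` is needed.
  have hs := (((b.hasSum_inner_mul_inner v (permOp hε (V ξ))).mul_left lam').add
    ((b.hasSum_inner_mul_inner v (permOp hε V')).mul_left (μ : ℂ))).sub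
    ((b.hasSum_inner_mul_inner (permOp hε v) V').mul_left (μ : ℂ))
  rw [inner_permOp_left, add_sub_cancel_right] at hs
  refine hs.congr_fun ?_
  intro l
  linear_combination (⟪v, b l⟫_ℂ) * hd l - (⟪b l, V'⟫_ℂ) * hv.conj l

theorem memLp_expMode_fst (L : ℝ) (p : ℤ) :
    MemLp (fun x : ℝ × ℝ => expMode p x.1) ∞ (planeMeasure L) :=
  memLp_top_of_bound ((contDiff_expMode p).continuous.comp continuous_fst).aestronglyMeasurable 1
    (Eventually.of_forall fun x => (norm_expMode p x.1).le)

/-- Multiplication by `e^{2πipx₁}`. -/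
def expOp (L : ℝ) (p : ℤ) : PlaneL2 L →L[ℂ] PlaneL2 L := mulOp (memLp_expMode_fst L p)

theorem inner_expOp_left {L : ℝ} (p : ℤ) (u v : PlaneL2 L) :
    ⟪expOp L p u, v⟫_ℂ = ⟪u, expOp L (-p) v⟫_ℂ := by
  have : MemLp (fun x : ℝ × ℝ => conj (expMode p x.1)) ∞ (planeMeasure L) := by
    simp only [conj_expMode]; exact memLp_expMode_fst L (-p)
  rw [expOp, inner_mulOp_left _ this, expOp]
  congr 2
  simp only [conj_expMode]

theorem expOp_planeBasis {L : ℝ} (hL : 0 < L) (γ : LateralBC) (p : ℤ) (l : ℤ × γ.index) :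
    expOp L (-p) (planeBasis hL γ l) = planeBasis hL γ (l.1 - p, l.2) := by
  refine Lp.ext ?_
  filter_upwards [coeFn_mulOp (memLp_expMode_fst L (-p)) (planeBasis hL γ l),
    coeFn_planeBasis hL γ l, coeFn_planeBasis hL γ (l.1 - p, l.2)] with x h1 h2 h3
  rw [h3]
  refine h1.trans ?_
  rw [h2, ← mul_assoc, ← expMode_add, neg_add_eq_sub]

/-- Up to the factor `2πp`, the weight is a difference of two symbols. Inserting both equations
leaves `μ` times a commutator-type difference that vanishes, as `ε` is real and commutes with
`e^{2πipx₁}`. -/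
theorem hasSum_shifted {L : ℝ} {hL : 0 < L} {γ : LateralBC} {ε : ℝ × ℝ → ℝ}
    {hε : IsPermittivity L ε} {ξ μ : ℝ} {v w : PlaneL2 L} (hv : IsCoeffSolution hL γ hε ξ μ v)
    (hw : IsCoeffSolution hL γ hε ξ μ w) {p : ℤ} (hp : p ≠ 0) :
    HasSum (fun l : ℤ × γ.index =>
      ((2 * Real.pi * l.1 + ξ : ℂ) + (2 * Real.pi * (l.1 - p : ℤ) + ξ)) *
        (⟪planeBasis hL γ l, v⟫_ℂ * ⟪w, planeBasis hL γ (l.1 - p, l.2)⟫_ℂ)) 0 := by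
  set b := planeBasis hL γ with hb
  have h1 : ∀ (w : PlaneL2 L) (l : ℤ × γ.index), ⟪w, b (l.1 - p, l.2)⟫_ℂ = ⟪expOp L p w, b l⟫_ℂ :=
    fun w l => by rw [inner_expOp_left, hb, expOp_planeBasis]
  have hs := ((b.hasSum_inner_mul_inner (expOp L p w) (permOp hε v)).mul_left (μ : ℂ)).sub
    ((b.hasSum_inner_mul_inner (expOp L p (permOp hε w)) v).mul_left (μ : ℂ))
  have h2 : expOp L p (permOp hε w) = permOp hε (expOp L p w) := mulOp_mulOp_comm _ _ _
  rw [h2, inner_permOp_left, sub_self] at hs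
  have hpi : (2 * Real.pi * p : ℂ) ≠ 0 := by
    have : (Real.pi : ℂ) ≠ 0 := by exact_mod_cast Real.pi_ne_zero
    have : (p : ℂ) ≠ 0 := by exact_mod_cast hp
    simp_all
  have hs2 := hs.mul_left ((2 * Real.pi * p : ℂ)⁻¹)
  rw [mul_zero] at hs2
  refine hs2.congr_fun fun l => ?_
  rw [eq_inv_mul_iff_mul_eq₀ hpi]
  have e1 := hv l
  have e2 := hw.conj (l.1 - p, l.2)
  rw [← h2, ← h1, ← h1]
  -- Difference of squares; the lateral part `κ²` drops out because the shift leaves `l.2` alone.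
  have e3 : symbol L γ ξ (l.1, l.2) - symbol L γ ξ (l.1 - p, l.2)
      = 2 * Real.pi * p * ((2 * Real.pi * l.1 + ξ : ℂ) + (2 * Real.pi * (l.1 - p : ℤ) + ξ)) := by
    simp only [symbol]; push_cast; ring
  rw [← mul_assoc, ← e3]
  linear_combination (⟪w, b (l.1 - p, l.2)⟫_ℂ) * e1 - (⟪b l, v⟫_ℂ) * e2

/-! ### Curves given by Fourier series -/

theorem hasSum_inner_of_summable_norm {E : Type*} [NormedAddCommGroup E] [InnerProductSpace ℂ E]
    [CompleteSpace E] {ι κ : Type*} {f : ι → E} {g : κ → E}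
    (hf : Summable fun i => ‖f i‖) (hg : Summable fun j => ‖g j‖) :
    HasSum (fun q : κ × ι => ⟪f q.2, g q.1⟫_ℂ) ⟪∑' i, f i, ∑' j, g j⟫_ℂ := by
  have hs : Summable fun q : κ × ι => ⟪f q.2, g q.1⟫_ℂ := by
    refine Summable.of_norm_bounded (g := fun q : κ × ι => ‖g q.1‖ * ‖f q.2‖)
      (hg.mul_of_nonneg hf (fun _ => norm_nonneg _) fun _ => norm_nonneg _) fun q => ?_
    rw [mul_comm]
    exact norm_inner_le_norm _ _
  have h1 := hs.hasSum.prod_fiberwise fun j => (hs.prod_factor j).hasSum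
  have h2 : ∀ j, ∑' i, ⟪f i, g j⟫_ℂ = ⟪∑' i, f i, g j⟫_ℂ := fun j => by
    have := (hf.of_norm.hasSum.mapL (innerSL ℂ (g j)))
    have h3 := this.star
    simp only [innerSL_apply_apply, RCLike.star_def, inner_conj_symm] at h3
    exact h3.tsum_eq
  have h3 := (hg.of_norm.hasSum).mapL (innerSL ℂ (∑' i, f i))
  simp only [innerSL_apply_apply] at h3
  simp only [h2] at h1
  rw [h3.unique h1]
  exact hs.hasSum

/-- The wave number `2πn + ξ`. -/
def waveNumber (ξ : ℝ) (n : ℤ) : ℝ := 2 * Real.pi * n + ξ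

/-- The term `e^{i(2πn+ξ)x} c_n`. -/
def waveTerm {L : ℝ} (ξ : ℝ) (c : ℤ → CrossL2 L) (n : ℤ) (x : ℝ) : CrossL2 L :=
  Complex.exp (Complex.I * waveNumber ξ n * x) • c n

/-- The curve `x ↦ ∑ₙ e^{i(2πn+ξ)x} c_n`. -/
def waveCurve {L : ℝ} (ξ : ℝ) (c : ℤ → CrossL2 L) (x : ℝ) : CrossL2 L := ∑' n, waveTerm ξ c n x

/-- The derivative `x ↦ ∑ₙ i(2πn+ξ) e^{i(2πn+ξ)x} c_n` of the wave curve. -/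
def waveDeriv {L : ℝ} (ξ : ℝ) (c : ℤ → CrossL2 L) (x : ℝ) : CrossL2 L :=
  ∑' n, (Complex.I * waveNumber ξ n) • waveTerm ξ c n x

theorem norm_exp_I_mul_mul (k x : ℝ) : ‖Complex.exp (Complex.I * k * x)‖ = 1 := by
  have : Complex.I * k * x = (k * x : ℝ) * Complex.I := by push_cast; ring
  rw [this, Complex.norm_exp_ofReal_mul_I]

section

variable {L : ℝ} (ξ : ℝ) {c d : ℤ → CrossL2 L}

theorem norm_waveTerm (c : ℤ → CrossL2 L) (n : ℤ) (x : ℝ) : ‖waveTerm ξ c n x‖ = ‖c n‖ := by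
  rw [waveTerm, norm_smul, norm_exp_I_mul_mul, one_mul]

theorem norm_waveDeriv_term (c : ℤ → CrossL2 L) (n : ℤ) (x : ℝ) :
    ‖(Complex.I * waveNumber ξ n) • waveTerm ξ c n x‖ = |waveNumber ξ n| * ‖c n‖ := by
  rw [norm_smul, norm_waveTerm, norm_mul, Complex.norm_I, one_mul, Complex.norm_real,
    Real.norm_eq_abs]

theorem summable_norm_of_weighted (hc : Summable fun n : ℤ => (1 + |2 * Real.pi * n|) * ‖c n‖) :
    Summable fun n => ‖c n‖ := by
  refine hc.of_nonneg_of_le (fun _ => norm_nonneg _) fun n => ?_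
  have := mul_nonneg (abs_nonneg (2 * Real.pi * (n : ℝ))) (norm_nonneg (c n))
  linarith

theorem summable_waveNumber_mul_norm (hc : Summable fun n : ℤ => (1 + |2 * Real.pi * n|) * ‖c n‖) :
    Summable fun n : ℤ => |waveNumber ξ n| * ‖c n‖ := by
  refine (hc.add ((summable_norm_of_weighted hc).mul_left |ξ|)).of_nonneg_of_le
    (fun _ => by positivity) fun n => ?_
  have h1 : |waveNumber ξ n| ≤ |2 * Real.pi * n| + |ξ| := abs_add_le _ _
  have := mul_le_mul_of_nonneg_right h1 (norm_nonneg (c n))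
  linarith [norm_nonneg (c n)]

theorem hasDerivAt_waveTerm (c : ℤ → CrossL2 L) (n : ℤ) (x : ℝ) :
    HasDerivAt (waveTerm ξ c n) ((Complex.I * waveNumber ξ n) • waveTerm ξ c n x) x := by
  have h := ((hasDerivAt_id' x).ofReal_comp.const_mul (Complex.I * waveNumber ξ n)).cexp.smul_const
    (c n)
  refine h.congr_deriv ?_
  rw [waveTerm, smul_smul]
  congr 1
  push_cast; ring

theorem hasDerivAt_waveCurve (hc : Summable fun n : ℤ => (1 + |2 * Real.pi * n|) * ‖c n‖) (x : ℝ) :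
    HasDerivAt (waveCurve ξ c) (waveDeriv ξ c x) x :=
  hasDerivAt_tsum (summable_waveNumber_mul_norm ξ hc) (fun n y => hasDerivAt_waveTerm ξ c n y)
    (fun n y => (norm_waveDeriv_term ξ c n y).le) (y₀ := 0)
    (Summable.of_norm (by simpa only [norm_waveTerm] using summable_norm_of_weighted hc)) x

theorem continuous_waveDeriv (hc : Summable fun n : ℤ => (1 + |2 * Real.pi * n|) * ‖c n‖) :
    Continuous (waveDeriv ξ c) :=
  continuous_tsum
    (fun n => (continuous_iff_continuousAt.2 fun x =>
      (hasDerivAt_waveTerm ξ c n x).continuousAt).const_smul (Complex.I * (waveNumber ξ n : ℂ)))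
    (summable_waveNumber_mul_norm ξ hc) fun n x => (norm_waveDeriv_term ξ c n x).le

theorem contDiff_waveCurve (hc : Summable fun n : ℤ => (1 + |2 * Real.pi * n|) * ‖c n‖) :
    ContDiff ℝ 1 (waveCurve ξ c) := by
  rw [contDiff_one_iff_deriv]
  refine ⟨fun x => (hasDerivAt_waveCurve ξ hc x).differentiableAt, ?_⟩
  rw [funext fun x => (hasDerivAt_waveCurve ξ hc x).deriv]
  exact continuous_waveDeriv ξ hc

/-- The equivalence `(p, n) ↦ (n, n - p)`. -/
def shiftEquiv : ℤ × ℤ ≃ ℤ × ℤ where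
  toFun q := (q.2, q.2 - q.1)
  invFun q := (q.1 - q.2, q.1)
  left_inv q := by ext <;> simp
  right_inv q := by ext <;> simp

/-- Absolute convergence permits regrouping the double series along `p = n - m`. Each group carries
the common phase `e^{2πipx}`, and only `p = 0`, whose phase is `1`, survives. -/
theorem inner_waveCurve_sub (hc : Summable fun n : ℤ => (1 + |2 * Real.pi * n|) * ‖c n‖)
    (hd : Summable fun n : ℤ => (1 + |2 * Real.pi * n|) * ‖d n‖) {S : ℂ}
    (h : ∀ p : ℤ, HasSum (fun n : ℤ =>
      ((waveNumber ξ n : ℂ) + waveNumber ξ (n - p)) * ⟪d (n - p), c n⟫_ℂ) (if p = 0 then S else 0))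
    (x : ℝ) :
    ⟪waveCurve ξ d x, waveDeriv ξ c x⟫_ℂ - ⟪waveDeriv ξ d x, waveCurve ξ c x⟫_ℂ
      = Complex.I * S := by
  have s1 : ∀ {c : ℤ → CrossL2 L}, (Summable fun n : ℤ => (1 + |2 * Real.pi * n|) * ‖c n‖) →
      Summable fun n => ‖waveTerm ξ c n x‖ := fun hc => by
    simpa only [norm_waveTerm] using summable_norm_of_weighted hc
  have s2 : ∀ {c : ℤ → CrossL2 L}, (Summable fun n : ℤ => (1 + |2 * Real.pi * n|) * ‖c n‖) →
      Summable fun n => ‖(Complex.I * (waveNumber ξ n : ℂ)) • waveTerm ξ c n x‖ := fun hc => by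
    simpa only [norm_waveDeriv_term] using summable_waveNumber_mul_norm ξ hc
  have h1 := (hasSum_inner_of_summable_norm (s1 hd) (s2 hc)).sub
    (hasSum_inner_of_summable_norm (s2 hd) (s1 hc))
  have h2 := (shiftEquiv.hasSum_iff.2 h1).prod_fiberwise
    (g := fun p => Complex.I * expMode p x * if p = 0 then S else 0) fun p => by
      refine ((h p).mul_left (Complex.I * expMode p x)).congr_fun fun n => ?_
      simp only [Function.comp, shiftEquiv, Equiv.coe_fn_mk, inner_smul_left, inner_smul_right,
        waveTerm, map_mul, Complex.conj_I, Complex.conj_ofReal, ← Complex.exp_conj]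
      have e : expMode p x = Complex.exp (Complex.I * waveNumber ξ n * x)
          * Complex.exp (-Complex.I * waveNumber ξ (n - p) * x) := by
        rw [expMode, ← Complex.exp_add]
        congr 1
        simp only [waveNumber]; push_cast; ring
      rw [e]
      ring
  have h3 := hasSum_single (f := fun p : ℤ => Complex.I * expMode p x * if p = 0 then S else 0) 0
    fun p hp => by rw [if_neg hp, mul_zero]
  have h4 := h2.unique h3
  have e0 : expMode 0 x = 1 := by simp [expMode]
  rw [if_pos rfl, e0, mul_one] at h4
  exact h4

end

/-! ### The partial Fourier coefficients of a function on the period cell -/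

/-- The partial Fourier coefficient `x₂ ↦ ∫₀¹ v(x₁, x₂) e^{-2πinx₁} dx₁`. -/
def partialCoeff {L : ℝ} (v : PlaneL2 L) (n : ℤ) : CrossL2 L :=
  ContinuousLinearMap.adjoint (tensorL (crossMeasure 1) (crossMeasure L) (expLp n)) v

theorem inner_crossBasis_partialCoeff {L : ℝ} (hL : 0 < L) (γ : LateralBC) (v : PlaneL2 L) (n : ℤ)
    (j : γ.index) :
    ⟪crossBasis hL γ j, partialCoeff v n⟫_ℂ = ⟪planeBasis hL γ (n, j), v⟫_ℂ := by
  rw [partialCoeff, ContinuousLinearMap.adjoint_inner_right, tensorL_apply, crossBasis_apply,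
    planeBasis_apply]

/-- Parseval in `x₂` alone; it collapses the sums over all modes to sums over `n`. -/
theorem hasSum_inner_partialCoeff {L : ℝ} (hL : 0 < L) (γ : LateralBC) (v w : PlaneL2 L)
    (m n : ℤ) : HasSum (fun j : γ.index =>
      ⟪planeBasis hL γ (n, j), v⟫_ℂ * ⟪w, planeBasis hL γ (m, j)⟫_ℂ)
      ⟪partialCoeff w m, partialCoeff v n⟫_ℂ := by
  refine ((crossBasis hL γ).hasSum_inner_mul_inner (partialCoeff w m)
    (partialCoeff v n)).congr_fun fun j => ?_
  rw [inner_crossBasis_partialCoeff, ← inner_conj_symm (partialCoeff w m), inner_crossBasis_partialCoeff,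
    inner_conj_symm, mul_comm]

theorem hasSum_norm_sq_partialCoeff {L : ℝ} (hL : 0 < L) (γ : LateralBC) (v : PlaneL2 L) (n : ℤ) :
    HasSum (fun j : γ.index => ‖⟪planeBasis hL γ (n, j), v⟫_ℂ‖ ^ 2) (‖partialCoeff v n‖ ^ 2) := by
  have h := hasSum_inner_partialCoeff hL γ v v n n
  rw [inner_self_eq_norm_sq_to_K] at h
  have h2 : ∀ j : γ.index, ⟪planeBasis hL γ (n, j), v⟫_ℂ * ⟪v, planeBasis hL γ (n, j)⟫_ℂ
      = ((‖⟪planeBasis hL γ (n, j), v⟫_ℂ‖ ^ 2 : ℝ) : ℂ) := fun j => by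
    rw [← inner_conj_symm v, Complex.mul_conj, Complex.normSq_eq_norm_sq]
  simp only [h2] at h
  have h3 := Complex.hasSum_re h
  simp only [Complex.ofReal_re] at h3
  convert h3 using 1
  norm_cast

/-- `H2` bounds `∑ (1+k²)² ‖c_n‖²` with `k = 2πn`. Writing `(1+|k|)‖c_n‖` as `(1+k²)‖c_n‖` times
`(1+|k|)/(1+k²)`, a product of two square-summable sequences, gives the `ℓ¹` bound that a `C¹` curve
requires. -/
theorem summable_weighted_partialCoeff {L : ℝ} (hL : 0 < L) {γ : LateralBC} {u : CellL2 L}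
    (hu : u ∈ H2 L γ) :
    Summable fun n : ℤ => (1 + |2 * Real.pi * n|) * ‖partialCoeff (toPlane L u) n‖ := by
  set v := toPlane L u with hv
  have h1 : Summable fun n : ℤ => (1 + (2 * Real.pi * n) ^ 2) ^ 2 * ‖partialCoeff v n‖ ^ 2 := by
    have h2 : Summable fun l : ℤ × γ.index =>
        (1 + (2 * Real.pi * l.1) ^ 2) ^ 2 * ‖⟪planeBasis hL γ l, v⟫_ℂ‖ ^ 2 := by
      refine Summable.of_nonneg_of_le (fun _ => by positivity) (fun l => ?_) hu
      rw [hv, inner_planeBasis_toPlane]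
      refine mul_le_mul_of_nonneg_right (pow_le_pow_left₀ (by positivity) ?_ 2) (sq_nonneg _)
      linarith [sq_nonneg (γ.freq L l.2)]
    refine h2.prod.congr fun n => ?_
    simp only [tsum_mul_left]
    rw [(hasSum_norm_sq_partialCoeff hL γ v n).tsum_eq]
  have h2 : Summable fun n : ℤ => 1 / (1 + (2 * Real.pi * n) ^ 2) := by
    refine Summable.of_norm_bounded_eventually (g := fun n : ℤ => 1 / (n : ℝ) ^ 2)
      (Real.summable_one_div_int_pow.2 one_lt_two) ?_
    have : ∀ᶠ n : ℤ in cofinite, n ≠ 0 := (finite_singleton (0 : ℤ)).eventually_cofinite_notMem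
    filter_upwards [this] with n hn
    rw [Real.norm_of_nonneg (by positivity)]
    have hn' : (0 : ℝ) < (n : ℝ) ^ 2 := by positivity
    refine one_div_le_one_div_of_le hn' ?_
    have := Real.pi_gt_three
    have h3 : 1 ≤ (2 * Real.pi) ^ 2 := one_le_pow₀ (by linarith)
    rw [mul_pow]
    linarith [mul_le_mul_of_nonneg_right h3 hn'.le]
  refine (h1.add (h2.mul_left 2)).of_nonneg_of_le (fun _ => by positivity) fun n => ?_
  set t := |2 * Real.pi * (n : ℝ)| with ht
  rw [← sq_abs (2 * Real.pi * (n : ℝ)), ← ht]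
  set r := ‖partialCoeff v n‖
  have hpos : 0 < 1 + t ^ 2 := by positivity
  have h3 : (1 + t) ^ 2 ≤ 2 * (1 + t ^ 2) := by nlinarith [sq_nonneg (1 - t)]
  have h4 : ((1 + t) / (1 + t ^ 2)) ^ 2 ≤ 2 * (1 / (1 + t ^ 2)) := by
    rw [div_pow, div_le_iff₀ (by positivity)]
    calc (1 + t) ^ 2 ≤ 2 * (1 + t ^ 2) := h3
      _ = 2 * (1 / (1 + t ^ 2)) * (1 + t ^ 2) ^ 2 := by field_simp
  have h5 : (1 + t) * r = ((1 + t ^ 2) * r) * ((1 + t) / (1 + t ^ 2)) := by field_simp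
  have h6 : ((1 + t ^ 2) * r) ^ 2 = (1 + t ^ 2) ^ 2 * r ^ 2 := mul_pow _ _ _
  rw [h5]
  nlinarith [sq_nonneg ((1 + t ^ 2) * r - (1 + t) / (1 + t ^ 2)),
    sq_nonneg ((1 + t ^ 2) * r), sq_nonneg ((1 + t) / (1 + t ^ 2))]

theorem hasSum_tensorLp_partialCoeff {L : ℝ} (hL : 0 < L) (v : PlaneL2 L) :
    HasSum (fun n => tensorLp (expLp n) (partialCoeff v n)) v := by
  -- Any lateral condition would do here: the partial coefficients do not depend on it.
  have h := (planeBasis hL .dirichlet).hasSum_repr v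
  refine h.prod_fiberwise fun n => ?_
  have h1 := ((crossBasis hL .dirichlet).hasSum_repr (partialCoeff v n)).mapL
    (tensorL (crossMeasure 1) (crossMeasure L) (expLp n))
  refine h1.congr_fun fun j => ?_
  rw [map_smul, HilbertBasis.repr_apply_apply, HilbertBasis.repr_apply_apply,
    inner_crossBasis_partialCoeff, planeBasis_apply, crossBasis_apply, tensorL_apply]

/-! ### Cross-sectional traces -/

theorem enorm_sq_eq_lintegral {α : Type*} [MeasurableSpace α] {μ : Measure α} (f : Lp ℂ 2 μ) :
    ‖f‖ₑ ^ 2 = ∫⁻ x, ‖f x‖ₑ ^ 2 ∂μ := by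
  have h := eLpNorm_nnreal_pow_eq_lintegral (f := f) (μ := μ) (p := 2) two_ne_zero
  rw [Lp.enorm_def]
  simpa using h

/-- The remainders tend to `0` in `L²` of the rectangle, so by Fatou their sections have norms with
lower limit `0` for almost every `x`. On each such section the series also converges absolutely,
which identifies its sum. -/
theorem ae_section_eq_tsum {L : ℝ} {v : PlaneL2 L} {c : ℤ → CrossL2 L}
    (hc : Summable fun n => ‖c n‖) (hv : HasSum (fun n => tensorLp (expLp n) (c n)) v) :
    ∀ᵐ x ∂(crossMeasure 1),
      (∑' n, expMode n x • c n : CrossL2 L) =ᵐ[crossMeasure L] fun y => v (x, y) := by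
  -- A sequence of finite sets keeps the exceptional null sets countable and makes Fatou applicable.
  obtain ⟨G, hG⟩ := exists_seq_tendsto (atTop : Filter (Finset ℤ))
  set R : ℕ → PlaneL2 L := fun N => v - ∑ n ∈ G N, tensorLp (expLp n) (c n) with hR
  set D : ℕ → ℝ → ℝ≥0∞ := fun N x => ∫⁻ y, ‖R N (x, y)‖ₑ ^ 2 ∂(crossMeasure L) with hD
  have hm : ∀ N, Measurable fun z => ‖R N z‖ₑ ^ 2 := fun N =>
    (Lp.stronglyMeasurable (R N)).measurable.enorm.pow_const 2
  have hDm : ∀ N, Measurable (D N) := fun N => (hm N).lintegral_prod_right'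
  have hDi : ∀ N, ∫⁻ x, D N x ∂(crossMeasure 1) = ‖R N‖ₑ ^ 2 := fun N => by
    rw [enorm_sq_eq_lintegral, lintegral_prod _ (hm N).aemeasurable]
  have hR0 : Tendsto (fun N => ‖R N‖ₑ ^ 2) atTop (𝓝 0) := by
    have h1 : Tendsto R atTop (𝓝 (v - v)) := tendsto_const_nhds.sub (hv.comp hG)
    have h2 := ENNReal.Tendsto.pow (n := 2) h1.enorm
    simpa using h2
  have hlim : ∀ᵐ x ∂(crossMeasure 1), liminf (fun N => D N x) atTop = 0 := by
    have h1 := lintegral_liminf_le (μ := crossMeasure 1) (u := atTop) hDm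
    simp only [hDi, hR0.liminf_eq, nonpos_iff_eq_zero] at h1
    exact (lintegral_eq_zero_iff (Measurable.liminf hDm)).1 h1
  have hmem : ∀ᵐ x ∂(crossMeasure 1), MemLp (fun y => v (x, y)) 2 (crossMeasure L) := by
    have h1 := (memLp_two_iff_integrable_sq_norm (Lp.memLp v).1).1 (Lp.memLp v)
    filter_upwards [(Lp.memLp v).1.prodMk_left, h1.prod_right_ae] with x hx1 hx2
    exact (memLp_two_iff_integrable_sq_norm hx1).2 hx2
  have hRe : ∀ᵐ x ∂(crossMeasure 1), ∀ N : ℕ, ∀ᵐ y ∂(crossMeasure L),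
      R N (x, y) = v (x, y) - ∑ n ∈ G N, expMode n x * c n y := by
    rw [ae_all_iff]
    intro N
    refine Measure.ae_ae_of_ae_prod
      (p := fun z => R N z = v z - ∑ n ∈ G N, expMode n z.1 * c n z.2) ?_
    have h1 : ∀ n, ∀ᵐ z ∂(planeMeasure L), tensorLp (expLp n) (c n) z
        = expMode n z.1 * c n z.2 := fun n => by
      filter_upwards [coeFn_tensorLp (expLp n) (c n),
        ae_prod_fst (ν := crossMeasure L) (coeFn_expLp n)] with z hz1 hz2
      rw [hz1, hz2]
    filter_upwards [ae_all_iff.2 h1, Lp.coeFn_sub v (∑ n ∈ G N, tensorLp (expLp n) (c n)),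
      Lp.coeFn_fun_finsetSum (G N) fun n => tensorLp (expLp n) (c n)] with z hz1 hz2 hz3
    rw [hR, hz2, Pi.sub_apply, hz3]
    simp only [hz1]
  filter_upwards [hlim, hmem, hRe] with x hx1 hx2 hx3
  set V : CrossL2 L := hx2.toLp _ with hV
  have hsum : HasSum (fun n => expMode n x • c n) (∑' n, expMode n x • c n) :=
    (Summable.of_norm (by simpa only [norm_smul, norm_expMode, one_mul] using hc)).hasSum
  have h1 : ∀ N, D N x = ‖V - ∑ n ∈ G N, expMode n x • c n‖ₑ ^ 2 := fun N => by
    rw [enorm_sq_eq_lintegral]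
    refine lintegral_congr_ae ?_
    filter_upwards [hx3 N, hx2.coeFn_toLp, Lp.coeFn_sub V (∑ n ∈ G N, expMode n x • c n),
      Lp.coeFn_fun_finsetSum (G N) fun n => expMode n x • c n,
      ae_all_iff.2 fun n => Lp.coeFn_smul (expMode n x) (c n)] with y h1 h2 h3 h4 h5
    rw [h1, h3, Pi.sub_apply, h4, hV, h2]
    simp only [h5, Pi.smul_apply, smul_eq_mul]
  have h2 : Tendsto (fun N => D N x) atTop (𝓝 (‖V - ∑' n, expMode n x • c n‖ₑ ^ 2)) := by
    simp only [h1]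
    exact ENNReal.Tendsto.pow (tendsto_const_nhds.sub (hsum.comp hG)).enorm
  have h3 : V = ∑' n, expMode n x • c n := by
    have h4 := h2.liminf_eq.symm.trans hx1
    rw [pow_eq_zero_iff two_ne_zero, enorm_eq_zero, sub_eq_zero] at h4
    exact h4
  rw [← h3]
  exact hx2.coeFn_toLp

/-- The exceptional set is invariant under integer translations and null in a fundamental domain. -/
theorem ae_of_periodic {P : ℝ → Prop} (hP : Function.Periodic P 1)
    (h : ∀ᵐ x ∂(crossMeasure 1), P x) : ∀ᵐ x : ℝ, P x := by
  have hd := isAddFundamentalDomain_Ioc (T := (1 : ℝ)) one_pos 0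
  rw [ae_iff]
  refine hd.measure_zero_of_invariant _ (fun g => ?_) ?_
  · obtain ⟨k, hk⟩ := AddSubgroup.mem_zmultiples_iff.1 g.2
    ext x
    have h1 : P (-(g : ℝ) + x) = P x := by
      rw [add_comm, ← hk, ← sub_eq_add_neg]
      exact hP.sub_zsmul_eq k
    rw [mem_vadd_set_iff_neg_vadd_mem]
    change ¬ P (-(g : ℝ) + x) ↔ ¬ P x
    rw [h1]
  · have h1 : crossMeasure 1 = (volume : Measure ℝ).restrict (Ioc 0 (0 + 1)) := by
      rw [zero_add]; exact Measure.restrict_congr_set Ioo_ae_eq_Ioc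
    rw [h1, ae_iff, Measure.restrict_apply' measurableSet_Ioc] at h
    exact h

theorem waveTerm_eq_smul {L : ℝ} (ξ : ℝ) (c : ℤ → CrossL2 L) (n : ℤ) (x : ℝ) :
    waveTerm ξ c n x = Complex.exp (Complex.I * ξ * x) • expMode n x • c n := by
  rw [waveTerm, smul_smul, expMode, ← Complex.exp_add]
  congr 2
  rw [waveNumber]; push_cast; ring

theorem isTraceCurve_floquetMode {L : ℝ} (hL : 0 < L) {γ : LateralBC} {u : CellL2 L}
    (hu : u ∈ H2 L γ) (ξ : ℝ) :
    IsTraceCurve L (floquetMode ξ u) (waveCurve ξ (partialCoeff (toPlane L u))) := by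
  set c := partialCoeff (toPlane L u) with hc
  have hw : Summable fun n : ℤ => (1 + |2 * Real.pi * n|) * ‖c n‖ :=
    summable_weighted_partialCoeff hL hu
  refine ⟨contDiff_waveCurve ξ hw, ?_⟩
  have h1 : ∀ᵐ x : ℝ, (∑' n, expMode n x • c n : CrossL2 L) =ᵐ[crossMeasure L]
      fun y => periodicLift u (x, y) := by
    refine ae_of_periodic (fun x => ?_) ?_
    · simp only [expMode_add_one, periodicLift]
      simp
    · filter_upwards [ae_section_eq_tsum (summable_norm_of_weighted hw)
        (hasSum_tensorLp_partialCoeff hL (toPlane L u)),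
        Measure.ae_ae_of_ae_prod (coeFn_toPlane u)] with x hx1 hx2
      exact hx1.trans hx2
  filter_upwards [h1] with x hx
  have h2 : waveCurve ξ c x
      = Complex.exp (Complex.I * ξ * x) • (∑' n, expMode n x • c n : CrossL2 L) := by
    rw [waveCurve]
    simp only [waveTerm_eq_smul]
    refine Summable.tsum_const_smul _ (Summable.of_norm ?_)
    simpa only [norm_smul, norm_expMode, one_mul] using summable_norm_of_weighted hw
  rw [h2]
  filter_upwards [hx, Lp.coeFn_smul (Complex.exp (Complex.I * ξ * x))
    (∑' n, expMode n x • c n : CrossL2 L)] with y hy1 hy2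
  rw [hy2, Pi.smul_apply, hy1, floquetMode, smul_eq_mul, mul_comm]

theorem fluxForm_eq_inner {L : ℝ} {v w : ℝ × ℝ → ℂ} (x : ℝ) :
    fluxForm L x v w = ⟪traceCurve L w x, deriv (traceCurve L v) x⟫_ℂ
      - ⟪deriv (traceCurve L w) x, traceCurve L v x⟫_ℂ := by
  rw [fluxForm, L2.inner_def, L2.inner_def, ← integral_sub (L2.integrable_inner _ _)
    (L2.integrable_inner _ _)]
  rfl

/-- The flux of two Floquet modes for the same frequency is determined by the slope of the band. -/
theorem fluxForm_floquetMode {L : ℝ} (hL : 0 < L) {γ : LateralBC} {ε : ℝ × ℝ → ℝ}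
    (hε : IsPermittivity L ε) {U : Set ℂ} {lam : ℂ → ℂ} {W : ℂ → CellL2 L}
    (hband : IsBand L γ ε U lam W) {ξ μ : ℝ} (hξ : (ξ : ℂ) ∈ U) (hμ : lam ξ = μ) {u : CellL2 L}
    (hu : IsCellEigenfunction L γ ε ξ μ u) (x : ℝ) :
    fluxForm L x (floquetMode ξ (W ξ)) (floquetMode ξ u)
      = Complex.I * (deriv lam ξ * ⟪toPlane L u, permOp hε (toPlane L (W ξ))⟫_ℂ) := by
  have hUn := hband.isOpen.mem_nhds hξ
  have hlam : HasDerivAt lam (deriv lam ξ) ξ :=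
    (hband.lam_holomorphic.differentiableAt hUn).hasDerivAt
  have hW := (hband.w_holomorphic.differentiableAt hUn).hasDerivAt
  have hV : HasDerivAt (fun z => toPlane L (W z)) (toPlane L (deriv W ξ)) ξ :=
    (toPlane L).toContinuousLinearMap.hasFDerivAt.comp_hasDerivAt (ξ : ℂ) hW
  have hsol : ∀ᶠ z in 𝓝 (ξ : ℂ), IsCoeffSolution hL γ hε z (lam z) (toPlane L (W z)) := by
    filter_upwards [hUn] with z hz l
    exact symbol_mul_cellCoeff hL hε (hband.eigen z hz).mem_H2 (hband.eigen z hz).equation l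
  have hus : IsCoeffSolution hL γ hε ξ μ (toPlane L u) := fun l =>
    symbol_mul_cellCoeff hL hε hu.mem_H2 hu.equation l
  have hWs : IsCoeffSolution hL γ hε ξ μ (toPlane L (W ξ)) := hμ ▸ hsol.self_of_nhds
  have hH := (hband.eigen ξ hξ).mem_H2
  have t1 := isTraceCurve_floquetMode hL hH ξ
  have t2 := isTraceCurve_floquetMode hL hu.mem_H2 ξ
  have s1 := summable_weighted_partialCoeff hL hH
  have s2 := summable_weighted_partialCoeff hL hu.mem_H2
  rw [fluxForm_eq_inner, t1.traceCurve_eq, t2.traceCurve_eq,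
    (hasDerivAt_waveCurve ξ s1 x).deriv, (hasDerivAt_waveCurve ξ s2 x).deriv]
  refine inner_waveCurve_sub ξ s1 s2 (fun p => ?_) x
  -- The diagonal `p = 0` is the Hellmann–Feynman sum; the other shifts vanish.
  have key : HasSum (fun l : ℤ × γ.index => ((waveNumber ξ l.1 : ℂ) + waveNumber ξ (l.1 - p)) *
      (⟪planeBasis hL γ l, toPlane L (W ξ)⟫_ℂ
        * ⟪toPlane L u, planeBasis hL γ (l.1 - p, l.2)⟫_ℂ))
      (if p = 0 then deriv lam ξ * ⟪toPlane L u, permOp hε (toPlane L (W ξ))⟫_ℂ else 0) := by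
    by_cases hp : p = 0
    · subst hp
      rw [if_pos rfl]
      refine (hasSum_slope hlam hV hsol hμ hus).congr_fun fun l => ?_
      simp only [waveNumber, sub_zero]
      push_cast; ring
    · rw [if_neg hp]
      refine (hasSum_shifted hWs hus hp).congr_fun fun l => ?_
      simp only [waveNumber]
      push_cast; ring
  exact key.prod_fiberwise fun n =>
    (hasSum_inner_partialCoeff hL γ (toPlane L (W ξ)) (toPlane L u) (n - p) n).mul_left _

/-! ### Energy flux and group velocity -/

theorem fluxForm_swap {L : ℝ} (v w : ℝ × ℝ → ℂ) (x : ℝ) :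
    fluxForm L x w v = -conj (fluxForm L x v w) := by
  simp only [fluxForm_eq_inner, map_sub, inner_conj_symm]
  ring

theorem conj_inner_permOp {L : ℝ} {ε : ℝ × ℝ → ℝ} (hε : IsPermittivity L ε) (u v : PlaneL2 L) :
    conj ⟪u, permOp hε v⟫_ℂ = ⟪v, permOp hε u⟫_ℂ := by
  rw [inner_conj_symm, inner_permOp_left]

theorem IsBand.hasDerivAt_re {L : ℝ} {γ : LateralBC} {ε : ℝ × ℝ → ℝ} {U : Set ℂ}
    {lam : ℂ → ℂ} {w : ℂ → CellL2 L} (h : IsBand L γ ε U lam w) {ξ : ℝ} (hξ : (ξ : ℂ) ∈ U) :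
    HasDerivAt (fun α : ℝ => (lam α).re) (deriv lam ξ).re ξ :=
  (h.lam_holomorphic.differentiableAt (h.isOpen.mem_nhds hξ)).hasDerivAt.real_of_complex

theorem IsCellEigenfunction.inner_permOp_self {L : ℝ} {γ : LateralBC} {ε : ℝ × ℝ → ℝ}
    (hε : IsPermittivity L ε) {ξ μ : ℂ} {u : CellL2 L} (hu : IsCellEigenfunction L γ ε ξ μ u) :
    ∃ r : ℝ, 0 < r ∧ ⟪toPlane L u, permOp hε (toPlane L u)⟫_ℂ = r := by
  have h0 : toPlane L u ≠ 0 := fun h =>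
    hu.ne_zero ((toPlane L).injective (h.trans (map_zero _).symm))
  exact ⟨_, re_inner_permOp_self_pos hε h0,
    (Complex.conj_eq_iff_re.1 (conj_inner_permOp hε _ _)).symm⟩

/-- The derivative of a band function at a real quasi momentum with a real value is real. -/
theorem IsBand.deriv_eq_bandSlope {L : ℝ} (hL : 0 < L) {γ : LateralBC}
    {ε : ℝ × ℝ → ℝ} (hε : IsPermittivity L ε) {U : Set ℂ} {lam : ℂ → ℂ} {w : ℂ → CellL2 L}
    (h : IsBand L γ ε U lam w) {ξ μ : ℝ} (hξ : (ξ : ℂ) ∈ U) (hμ : lam ξ = μ) :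
    deriv lam ξ = bandSlope lam ξ := by
  rw [bandSlope, (h.hasDerivAt_re hξ).deriv]
  have hu := h.eigen ξ hξ
  obtain ⟨r, hr, hre⟩ := hu.inner_permOp_self hε
  have h1 := fluxForm_floquetMode hL hε h hξ hμ (hμ ▸ hu) 0
  -- Skew-Hermitian symmetry makes `q(v,v) = iλ'r` purely imaginary, so `λ'` is real since `r > 0`.
  have h2 := fluxForm_swap (L := L) (floquetMode ξ (w ξ)) (floquetMode ξ (w ξ)) 0
  rw [h1, hre] at h2
  simp only [map_mul, Complex.conj_I, Complex.conj_ofReal] at h2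
  have h3 : (deriv lam ξ - conj (deriv lam ξ)) * (Complex.I * r) = 0 := by linear_combination h2
  have h4 : Complex.I * r ≠ 0 := mul_ne_zero Complex.I_ne_zero (by exact_mod_cast hr.ne')
  have h5 := sub_eq_zero.1 ((mul_eq_zero.1 h3).resolve_right h4)
  exact (Complex.conj_eq_iff_re.1 h5.symm).symm

theorem im_fluxForm_pos_iff {L : ℝ} (hL : 0 < L) {γ : LateralBC}
    {ε : ℝ × ℝ → ℝ} (hε : IsPermittivity L ε) {U : Set ℂ} {lam : ℂ → ℂ} {w : ℂ → CellL2 L}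
    (h : IsBand L γ ε U lam w) {ξ μ : ℝ} (hξ : (ξ : ℂ) ∈ U) (hμ : lam ξ = μ) (x : ℝ) :
    0 < (fluxForm L x (floquetMode ξ (w ξ)) (floquetMode ξ (w ξ))).im ↔ 0 < bandSlope lam ξ := by
  have hu := h.eigen ξ hξ
  obtain ⟨r, hr, hre⟩ := hu.inner_permOp_self hε
  rw [fluxForm_floquetMode hL hε h hξ hμ (hμ ▸ hu) x, hre, h.deriv_eq_bandSlope hL hε hξ hμ,
    ← Complex.ofReal_mul, mul_comm, Complex.im_ofReal_mul, Complex.I_im, mul_one]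
  exact mul_pos_iff_of_pos_right hr

/-- Either band may serve as the differentiated one in the flux formula. Skew-Hermitian symmetry
then equates the same pairing multiplied by the two different slopes. -/
theorem fluxForm_eq_zero_of_bandSlope_ne {L : ℝ} (hL : 0 < L) {γ : LateralBC}
    {ε : ℝ × ℝ → ℝ} (hε : IsPermittivity L ε) {U U' : Set ℂ} {lam lam' : ℂ → ℂ}
    {w w' : ℂ → CellL2 L} (h : IsBand L γ ε U lam w) (h' : IsBand L γ ε U' lam' w') {ξ μ : ℝ}
    (hξ : (ξ : ℂ) ∈ U) (hξ' : (ξ : ℂ) ∈ U') (hμ : lam ξ = μ) (hμ' : lam' ξ = μ)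
    (hne : bandSlope lam' ξ ≠ bandSlope lam ξ) (x : ℝ) :
    fluxForm L x (floquetMode ξ (w ξ)) (floquetMode ξ (w' ξ)) = 0 := by
  have h1 := fluxForm_floquetMode hL hε h hξ hμ (hμ' ▸ h'.eigen ξ hξ') x
  have h2 := fluxForm_floquetMode hL hε h' hξ' hμ' (hμ ▸ h.eigen ξ hξ) x
  rw [h.deriv_eq_bandSlope hL hε hξ hμ] at h1
  rw [h'.deriv_eq_bandSlope hL hε hξ' hμ'] at h2
  have h3 := fluxForm_swap (L := L) (floquetMode ξ (w' ξ)) (floquetMode ξ (w ξ)) x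
  rw [h1, h2] at h3
  simp only [map_mul, Complex.conj_I, Complex.conj_ofReal, conj_inner_permOp] at h3
  have h4 : (Complex.I * ((bandSlope lam' ξ : ℂ) - bandSlope lam ξ))
      * ⟪toPlane L (w' ξ), permOp hε (toPlane L (w ξ))⟫_ℂ = 0 := by linear_combination -h3
  have h5 : Complex.I * ((bandSlope lam' ξ : ℂ) - bandSlope lam ξ) ≠ 0 :=
    mul_ne_zero Complex.I_ne_zero (sub_ne_zero.2 (by exact_mod_cast hne))
  rw [h1, (mul_eq_zero.1 h4).resolve_left h5, mul_zero, mul_zero]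

/-- The chain rule gives `λ' / (2√λ)`, with positive denominator. -/
theorem groupVelocity_pos_iff {L : ℝ} {γ : LateralBC} {ε : ℝ × ℝ → ℝ} {U : Set ℂ}
    {lam : ℂ → ℂ} {w : ℂ → CellL2 L} (h : IsBand L γ ε U lam w) {ξ : ℝ} (hξ : (ξ : ℂ) ∈ U)
    (hpos : 0 < (lam ξ).re) : 0 < groupVelocity lam ξ ↔ 0 < bandSlope lam ξ := by
  have hd := h.hasDerivAt_re hξ
  rw [groupVelocity, (hd.sqrt hpos.ne').deriv, bandSlope, hd.deriv]
  exact div_pos_iff_of_pos_right (by positivity)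

end PeriodicWaveguide

end

theorem mainTheorem10 (L : ℝ) (hL : 0 < L) (γ : PeriodicWaveguide.LateralBC)
    (ε : ℝ × ℝ → ℝ) (hε : PeriodicWaveguide.IsPermittivity L ε) (ω : ℝ) (hω : 0 < ω)
    (U : ℕ → Set ℂ) (lam : ℕ → ℂ → ℂ) (w : ℕ → ℂ → PeriodicWaveguide.CellL2 L)
    (hband : ∀ k, PeriodicWaveguide.IsBand L γ ε (U k) (lam k) (w k))
    (ξ : ℝ) (m : ℕ) (hm : (ξ : ℂ) ∈ U m) (hmω : lam m ξ = (ω : ℂ) ^ 2)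
    (hm' : PeriodicWaveguide.bandSlope (lam m) ξ ≠ 0) :
    PeriodicWaveguide.HasTraces L (PeriodicWaveguide.floquetMode ξ (w m ξ)) ∧
    (∀ x₁ : ℝ,
      0 < (PeriodicWaveguide.fluxForm L x₁ (PeriodicWaveguide.floquetMode ξ (w m ξ))
            (PeriodicWaveguide.floquetMode ξ (w m ξ))).im ↔
        0 < PeriodicWaveguide.bandSlope (lam m) ξ) ∧
    (0 < PeriodicWaveguide.groupVelocity (lam m) ξ ↔
        0 < PeriodicWaveguide.bandSlope (lam m) ξ) ∧
    ∀ n : ℕ, (ξ : ℂ) ∈ U n → lam n ξ = (ω : ℂ) ^ 2 →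
      PeriodicWaveguide.bandSlope (lam n) ξ ≠ PeriodicWaveguide.bandSlope (lam m) ξ →
      PeriodicWaveguide.HasTraces L (PeriodicWaveguide.floquetMode ξ (w n ξ)) ∧
      ∀ x₁ : ℝ,
        PeriodicWaveguide.fluxForm L x₁ (PeriodicWaveguide.floquetMode ξ (w m ξ))
          (PeriodicWaveguide.floquetMode ξ (w n ξ)) = 0 := by
  have hω2 : ∀ k, lam k ξ = (ω : ℂ) ^ 2 → lam k ξ = ((ω ^ 2 : ℝ) : ℂ) := fun k hk => by
    rw [hk, Complex.ofReal_pow]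
  have htr : ∀ k, (ξ : ℂ) ∈ U k →
      PeriodicWaveguide.HasTraces L (PeriodicWaveguide.floquetMode ξ (w k ξ)) := fun k hk =>
    ⟨_, PeriodicWaveguide.isTraceCurve_floquetMode hL ((hband k).eigen ξ hk).mem_H2 ξ⟩
  refine ⟨htr m hm, fun x₁ => ?_, ?_, fun n hn hnω hne => ⟨htr n hn, fun x₁ => ?_⟩⟩
  · exact PeriodicWaveguide.im_fluxForm_pos_iff hL hε (hband m) hm (hω2 m hmω) x₁
  · refine PeriodicWaveguide.groupVelocity_pos_iff (hband m) hm ?_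
    rw [hω2 m hmω, Complex.ofReal_re]
    positivity
  · exact PeriodicWaveguide.fluxForm_eq_zero_of_bandSlope_ne hL hε (hband m) (hband n) hm hn
      (hω2 m hmω) (hω2 n hnω) hne x₁
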